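/- **Conventions.** All trees are finite. A rooted tree $\tau$ is a tree with a distinguished vertex, its root; two rooted trees are *equal* if there is a graph isomorphism between them that maps root to root, and *equivalent* if their underlying graphs are isomorphic. Write $\tau=[\tau_1,\dots,\tau_m]$ if $\tau_1,\dots,\tau_m$ are the branches at the root of $\tau$ (each rooted at the corresponding neighbour of the root). The Butcher product is $[u_1,\dots,u_m]\circ v=[u_1,\dots,u_m,v]$. A rooted tree $\tau$ is *admissible* if all its vertices have degree at most $3$ and $\tau$ is not equivalent to $u\circ u$ for any rooted tree $u$. The symmetry coefficient is defined recursively by $\sigma(\bullet)=1$ and $\sigma([\tau_1,\dots,\tau_m])=\sigma(\tau_1)\cdots\sigma(\tau_m)\,\mu_1!\mu_2!\cdots$, where $\mu_1,\mu_2,\dots$ are the multiplicities of the distinct trees among $\tau_1,\dots,\tau_m$. Further, $\alpha(\tau)=2^{b(\tau)}$, where $b(\tau)$ is the degree of the root. For rooted trees $u$ and $v=[v_1,\dots,v_n]$ and $\mathbf v=(\nu_1,\dots,\nu_n)\in V(u)^n$, the merging product $u\times_{\mathbf v}v$ is the tree obtained from $u$ by joining, for each $i$, the root of $v_i$ by a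 new edge to $\nu_i$; its root is the root of $u$. Let $\tau$ be an admissible tree. A *labeling* is a map $l\colon V(\tau)\to\mathbb N$ whose values at adjacent vertices have different parity. For a subtree $w$ of $\tau$ let $\tau_w$ be the tree obtained by contracting $w$ to one vertex, which becomes the root. Let $W(\tau)$ be the set of subtrees $w\subsetneq\tau$ such that $w$ is a path with an odd number $|w|$ of vertices and every branch of $\tau_w$ at its root is a path rooted at an end vertex (possibly a single vertex). The middle vertex $r(w)$ is the root of $w$, and $\tau^w$ denotes $\tau$ with its root moved to $r(w)$. Subtrees $w,w'\in W(\tau)$ are equivalent if an automorphism of the graph of $\tau$ maps $w$ onto $w'$; $\overline W(\tau)$ is the set of equivalence classes. Put $c(w)=1$ if $|w|=1$ and $c(w)=\frac23(-1)^{(|w|-1)/2}$ if $|w|>1$. Finally, let $\omega_\tau(w)$ be the number of tuples $\mathbf v\in V(w)^{b(\tau_w)}$ (for a fixed ordering of the branches of $\tau_w$) such that $w\times_{\mathbf v}\tau_w$ and $\tau^w$ are equal as rooted trees containing $w$, that is, such that there is a root-preserving isomorphism $w\times_{\mathbf v}\tau_w\to\tau^w$ that maps the subtree $w$ onto $w$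 (not necessarily pointwise). **Statement.** For every admissible tree $\tau$, every labeling $l$ of $\tau$ and every choice of representatives $w$ of the classes $\bar w\in\overline W(\tau)$, $$C(\tau)=\sum_{\bar w\in\overline W(\tau)}\frac{\alpha(\tau_w)}{\sigma(\tau_w)}\,c(w)\,(-1)^{l(r(w))}\,\omega_\tau(w)=0 .$$ -/

import Mathlib

universe u

/-- A finite simple graph with a distinguished vertex, the root. Rooted trees are the rooted graphs
whose underlying graph is a tree (`RootedGraph.IsTree`), considered up to `ProperIso`. -/
structure RootedGraph : Type (u + 1) where
  V : Type u
  finite : Finite V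
  graph : SimpleGraph V
  root : V

namespace RootedGraph

attribute [instance] RootedGraph.finite

/-- The underlying graph is a tree. -/
def IsTree (t : RootedGraph.{u}) : Prop := t.graph.IsTree

/-- The degree of a vertex: the number of edges attached to it. -/
noncomputable def deg (t : RootedGraph.{u}) (x : t.V) : ℕ := (t.graph.neighborSet x).ncard

/-- Equivalence of trees: same graph, possibly another position of the root. -/
def RootEquiv (s t : RootedGraph.{u}) : Prop := Nonempty (s.graph ≃g t.graph)

/-- Proper isomorphism: a graph isomorphism that maps the root to the root.
This is equality of (unordered) rooted trees. -/
def ProperIso (s t : RootedGraph.{u}) : Prop :=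
  ∃ φ : s.graph ≃g t.graph, φ s.root = t.root

/-- The children of the root. -/
abbrev Children (t : RootedGraph.{u}) : Type u := {c : t.V // t.graph.Adj t.root c}

/-- The vertices that can be reached from `c` without passing through the root. -/
def branchVerts (t : RootedGraph.{u}) (c : t.V) : Set t.V :=
  {x | ∃ p : t.graph.Walk c x, t.root ∉ p.support}

/-- The branch of `t` at the child `c` of the root, itself rooted at `c`. If `c₁, …, cₘ` are the
children of the root of the tree `t`, then `t = [t.branch c₁, …, t.branch cₘ]`. -/
def branch (t : RootedGraph.{u}) (c : t.Children) : RootedGraph.{u} where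
  V := t.branchVerts c
  finite := inferInstance
  graph := t.graph.induce (t.branchVerts c)
  root := ⟨c, .nil, by simpa using c.2.ne⟩

theorem card_branch_lt (t : RootedGraph.{u}) (c : t.Children) :
    Nat.card (t.branch c).V < Nat.card t.V := by
  have h : t.root ∉ t.branchVerts c := by
    rintro ⟨p, hp⟩
    exact hp p.end_mem_support
  have h2 : (t.branchVerts c).ncard < (Set.univ : Set t.V).ncard :=
    Set.ncard_lt_ncard ⟨Set.subset_univ _, fun hs => h (hs (Set.mem_univ _))⟩ Set.finite_univ
  rw [Set.ncard_univ] at h2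
  exact h2

/-- Children of the root with equal (properly isomorphic) branches. -/
def childSetoid (t : RootedGraph.{u}) : Setoid t.Children where
  r c d := ProperIso (t.branch c) (t.branch d)
  iseqv :=
    { refl := fun _ => ⟨SimpleGraph.Iso.refl, rfl⟩
      symm := fun ⟨φ, h⟩ => ⟨φ.symm, by rw [← h]; exact φ.symm_apply_apply _⟩
      trans := fun ⟨φ, h⟩ ⟨ψ, k⟩ => ⟨ψ.comp φ, by
        rw [← k, ← h]
        rfl⟩ }

open Classical in
/-- The symmetry coefficient: `σ([τ₁, …, τₘ]) = σ(τ₁) ⋯ σ(τₘ) μ₁! μ₂! ⋯`, where the `μᵢ` count the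
equal trees among `τ₁, …, τₘ`. In particular it is `1` for the tree with one vertex. -/
noncomputable def sigma (t : RootedGraph.{u}) : ℕ :=
  letI := Fintype.ofFinite t.Children
  letI := Fintype.ofFinite (Quotient t.childSetoid)
  (∏ c : t.Children, sigma (t.branch c)) *
    ∏ q : Quotient t.childSetoid,
      Nat.factorial (Nat.card {c : t.Children // (Quotient.mk t.childSetoid c) = q})
termination_by Nat.card t.V
decreasing_by exact t.card_branch_lt c

/-- The branching number: the degree of the root. -/
noncomputable def branchingNumber (t : RootedGraph.{u}) : ℕ := t.deg t.root

/-- The branching factor. -/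
noncomputable def alpha (t : RootedGraph.{u}) : ℕ := 2 ^ t.branchingNumber

/-- The Butcher product `[u₁, …, uₘ] ∘ v = [u₁, …, uₘ, v]`: the root of `v` is joined by a new edge
to the root of `u`, which stays the root. -/
def butcher (s t : RootedGraph.{u}) : RootedGraph.{u} where
  V := s.V ⊕ t.V
  finite := inferInstance
  graph :=
    { Adj := fun a b => match a, b with
        | .inl a, .inl b => s.graph.Adj a b
        | .inr a, .inr b => t.graph.Adj a b
        | .inl a, .inr b => a = s.root ∧ b = t.root
        | .inr a, .inl b => b = s.root ∧ a = t.root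
      symm := ⟨by
        rintro (a | a) (b | b) h
        · exact SimpleGraph.Adj.symm h
        · exact h
        · exact h
        · exact SimpleGraph.Adj.symm h⟩
      loopless := ⟨by
        rintro (a | a) h
        · exact s.graph.irrefl h
        · exact t.graph.irrefl h⟩ }
  root := .inl s.root

/-- The merging product `s ×_f [t₁, …, tₙ]`: the root of `t` is removed, and the branch of `t` at the
child `c` of its root is attached by a new edge (ending in `c`) to the vertex `f c` of `s`. -/
def merge (s t : RootedGraph.{u}) (f : t.Children → s.V) : RootedGraph.{u} where
  V := s.V ⊕ {x : t.V // x ≠ t.root}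
  finite := inferInstance
  graph :=
    { Adj := fun a b => match a, b with
        | .inl a, .inl b => s.graph.Adj a b
        | .inr x, .inr y => t.graph.Adj x y
        | .inl a, .inr x => ∃ h : t.graph.Adj t.root x, f ⟨x, h⟩ = a
        | .inr x, .inl a => ∃ h : t.graph.Adj t.root x, f ⟨x, h⟩ = a
      symm := ⟨by
        rintro (a | a) (b | b) h
        · exact SimpleGraph.Adj.symm h
        · exact h
        · exact h
        · exact SimpleGraph.Adj.symm h⟩
      loopless := ⟨by
        rintro (a | a) h
        · exact s.graph.irrefl h
        · exact t.graph.irrefl h⟩ }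
  root := .inl s.root

/-- The tree `τ_w`: all vertices of `w` are contracted to one vertex (`none`), which is the root. -/
def contract (t : RootedGraph.{u}) (w : Set t.V) : RootedGraph.{u} where
  V := Option {x : t.V // x ∉ w}
  finite := inferInstance
  graph :=
    { Adj := fun a b => match a, b with
        | some x, some y => t.graph.Adj x y
        | none, some y => ∃ x ∈ w, t.graph.Adj x y
        | some y, none => ∃ x ∈ w, t.graph.Adj x y
        | none, none => False
      symm := ⟨by
        rintro (_ | a) (_ | b) h
        · exact h
        · exact h
        · exact h
        · exact SimpleGraph.Adj.symm h⟩
      loopless := ⟨by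
        rintro (_ | a) h
        · exact h
        · exact t.graph.irrefl h⟩ }
  root := none

/-- Tall trees: paths rooted at an end vertex (including the tree with one vertex). -/
def IsTall (t : RootedGraph.{u}) : Prop :=
  t.IsTree ∧ (∀ x, t.deg x ≤ 2) ∧ t.branchingNumber ≤ 1

/-- Trees with branching only at the root: all branches at the root are tall trees. -/
def BranchesOnlyAtRoot (t : RootedGraph.{u}) : Prop :=
  t.IsTree ∧ ∀ c : t.Children, (t.branch c).IsTall

/-- Admissible trees. -/
def Admissible (t : RootedGraph.{u}) : Prop :=
  t.IsTree ∧ (∀ x, t.deg x ≤ 3) ∧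
    ∀ s : RootedGraph.{u}, s.IsTree → ¬ t.RootEquiv (s.butcher s)

/-- A labeling: the parities of the labels of adjacent vertices differ. -/
def IsLabeling (t : RootedGraph.{u}) (l : t.V → ℕ) : Prop :=
  ∀ x y, t.graph.Adj x y → (-1 : ℤ) ^ l x = -(-1 : ℤ) ^ l y

/-- The tree `θ₂ₖ`: the path with `2k + 1` vertices, rooted at its middle vertex. -/
def theta (k : ℕ) : RootedGraph.{0} where
  V := Fin (2 * k + 1)
  finite := inferInstance
  graph := SimpleGraph.pathGraph (2 * k + 1)
  root := ⟨k, by omega⟩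

/-- Proper subtrees `w ∈ W(τ)`, given by their vertex sets. The root of `w` is its middle vertex;
it is determined by the condition that the induced subgraph on `w` with this root is `θ₂ₖ`. -/
@[ext]
structure ProperSubtree (t : RootedGraph.{u}) where
  verts : Set t.V
  root : t.V
  root_mem : root ∈ verts
  strict : verts ≠ Set.univ
  contract_mem : (t.contract verts).BranchesOnlyAtRoot
  path : ∃ (k : ℕ) (φ : (theta k).graph ≃g t.graph.induce verts),
    φ (theta k).root = ⟨root, root_mem⟩

instance (t : RootedGraph.{u}) : Finite t.ProperSubtree :=
  Finite.of_injective (fun w : t.ProperSubtree => (w.verts, w.root)) fun _ _ h =>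
    ProperSubtree.ext (congrArg Prod.fst h) (congrArg Prod.snd h)

/-- Subtrees are equivalent if an automorphism of (the graph of) `τ` maps one onto the other. -/
def subtreeSetoid (t : RootedGraph.{u}) : Setoid t.ProperSubtree where
  r w w' := ∃ φ : t.graph ≃g t.graph, φ '' w.verts = w'.verts
  iseqv :=
    { refl := fun w => ⟨SimpleGraph.Iso.refl, Set.image_id w.verts⟩
      symm := fun {w w'} ⟨φ, h⟩ => ⟨φ.symm, by
        rw [← h]
        exact φ.toEquiv.symm_image_image w.verts⟩
      trans := fun {w w' w''} ⟨φ, h⟩ ⟨ψ, k⟩ => ⟨ψ.comp φ, by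
        rw [← k, ← h, ← Set.image_comp]
        rfl⟩ }

/-- The set `W̄(τ)` of equivalence classes of proper subtrees. -/
abbrev SubtreeClass (t : RootedGraph.{u}) : Type u := Quotient t.subtreeSetoid

noncomputable instance (t : RootedGraph.{u}) : Fintype t.SubtreeClass := Fintype.ofFinite _

namespace ProperSubtree

variable {t : RootedGraph.{u}}

/-- The subtree `w` as a rooted tree of its own. -/
def toRooted (w : t.ProperSubtree) : RootedGraph.{u} where
  V := w.verts
  finite := inferInstance
  graph := t.graph.induce w.verts
  root := ⟨w.root, w.root_mem⟩

/-- The tree `τ_w`. -/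
abbrev quot (w : t.ProperSubtree) : RootedGraph.{u} := t.contract w.verts

/-- The tree `τ^w`: the graph of `τ` with the middle vertex of `w` as root. -/
def reroot (w : t.ProperSubtree) : RootedGraph.{u} where
  V := t.V
  finite := inferInstance
  graph := t.graph
  root := w.root

/-- The number `ω_τ(w)` of tuples `f` of vertices of `w`, indexed by the branches of `τ_w`, for which
the merging product `w ×_f τ_w` is `τ^w`. Both trees contain `w`, and they are identified by proper
isomorphisms that map the copy of `w` in `w ×_f τ_w` onto `w ⊆ τ^w` (as a set, so that `w` may be
reflected). -/
noncomputable def omega (w : t.ProperSubtree) : ℕ :=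
  Nat.card {f : w.quot.Children → w.toRooted.V //
    ∃ φ : (w.toRooted.merge w.quot f).graph ≃g w.reroot.graph,
      φ (w.toRooted.merge w.quot f).root = w.reroot.root ∧
      φ '' Set.range (Sum.inl : w.toRooted.V → (w.toRooted.merge w.quot f).V) = w.verts}

/-- The coefficient `c(w)`. -/
noncomputable def coeff (w : t.ProperSubtree) : ℚ :=
  if w.verts.ncard = 1 then 1 else 2 / 3 * (-1) ^ ((w.verts.ncard - 1) / 2)

end ProperSubtree

/-- The aggregated coefficient `C(τ)`, computed with a labeling `l` and a choice `rep` of a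
representative in each equivalence class of proper subtrees. -/
noncomputable def aggregated (t : RootedGraph.{u}) (l : t.V → ℕ)
    (rep : t.SubtreeClass → t.ProperSubtree) : ℚ :=
  ∑ q : t.SubtreeClass,
    ((rep q).quot.alpha : ℚ) / ((rep q).quot.sigma : ℚ) * (rep q).coeff *
      (-1) ^ l (rep q).root * ((rep q).omega : ℚ)

end RootedGraph

namespace SimpleGraph

variable {V : Type u} {G : SimpleGraph V}

/-- The vertices common to all walks from `x` to `y`. In a tree, these are the vertices of the path
from `x` to `y`. -/
def seg (G : SimpleGraph V) (x y : V) : Set V := {z | ∀ p : G.Walk x y, z ∈ p.support}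

/-- The vertices outside `S` that have a neighbor in `S`. -/
def outerBoundary (G : SimpleGraph V) (S : Set V) : Set V := {c | c ∉ S ∧ ∃ x ∈ S, G.Adj x c}

lemma IsAcyclic.seg_eq_support (hG : G.IsAcyclic) {x y : V} {p : G.Walk x y} (hp : p.IsPath) :
    G.seg x y = {z | z ∈ p.support} := by
  classical
  ext z
  refine ⟨fun h => h p, fun h q => ?_⟩
  have := Subtype.mk.inj <| (hG.subsingleton_path x y).elim ⟨p, hp⟩ q.toPath
  rw [Set.mem_ofPred_eq, this] at h
  exact q.support_toPath_subset_support h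

lemma seg_self (x : V) : G.seg x x = {x} := by
  ext z
  refine ⟨fun h => by simpa using h .nil, ?_⟩
  rintro rfl p
  exact p.start_mem_support

lemma left_mem_seg (x y : V) : x ∈ G.seg x y := fun p => p.start_mem_support

lemma right_mem_seg (x y : V) : y ∈ G.seg x y := fun p => p.end_mem_support

lemma seg_comm (x y : V) : G.seg x y = G.seg y x := by
  ext z
  exact ⟨fun h p => by simpa using h p.reverse, fun h p => by simpa using h p.reverse⟩

lemma IsTree.connected_induce_seg (hG : G.IsTree) (x y : V) :
    (G.induce (G.seg x y)).Connected := by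
  obtain ⟨p, hp, -⟩ := hG.existsUnique_path x y
  rw [hG.isAcyclic.seg_eq_support hp]
  exact p.connected_induce_support

/-- In an acyclic graph, a vertex outside a connected set has at most one neighbor in it. -/
lemma IsAcyclic.eq_of_adj_of_preconnected (hG : G.IsAcyclic) {T : Set V}
    (hT : (G.induce T).Preconnected) {a b c : V} (ha : a ∈ T) (hb : b ∈ T) (hc : c ∉ T)
    (hac : G.Adj a c) (hbc : G.Adj b c) : a = b := by
  obtain ⟨p, hp⟩ := (hT ⟨a, ha⟩ ⟨b, hb⟩).exists_isPath
  let q : G.Walk a b := p.map (Embedding.induce T).toHom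
  have hq : q.IsPath := Walk.IsPath.map Subtype.val_injective hp
  have hcq : c ∉ q.support := by
    intro h
    obtain ⟨d, -, rfl⟩ := List.mem_map.1 ((Walk.support_map _ _) ▸ h)
    exact hc d.2
  have hcq' : (Walk.cons hac.symm q).IsPath := by
    rw [Walk.cons_isPath_iff]; exact ⟨hq, hcq⟩
  have := hG.eq_snd_of_adj_start hcq' hbc.symm (by simp)
  simpa using this.symm

lemma IsTree.exists_parent (hG : G.IsTree) {x y : V} (hxy : x ≠ y) :
    ∃ p, G.Adj p x ∧ G.dist y x = G.dist y p + 1 ∧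
      (∀ q, G.Adj q x → G.dist y x = G.dist y q + 1 → q = p) ∧
      G.seg y x = insert x (G.seg y p) ∧ x ∉ G.seg y p := by
  classical
  obtain ⟨P, hP, hPl⟩ := hG.connected.exists_path_of_dist y x
  have hnil : ¬ P.Nil := fun h => hxy h.eq.symm
  have key : ∀ q, G.Adj q x → G.dist y x = G.dist y q + 1 → q ∈ P.support := by
    intro q hq hd
    obtain ⟨Q, hQ, hQl⟩ := hG.connected.exists_path_of_dist y q
    by_contra hcon
    have := hG.isAcyclic.path_concat hP hQ hq.symm
      (hG.isAcyclic.mem_support_of_ne_mem_support_of_adj_of_isPath hQ hP hq hcon)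
    have := congrArg Walk.length this
    rw [Walk.length_concat] at this
    omega
  have hadj : G.Adj P.penultimate x := P.adj_penultimate hnil
  obtain ⟨Q, hQ, hQl⟩ := hG.connected.exists_path_of_dist y P.penultimate
  have hPQ : P = Q.concat hadj :=
    hG.isAcyclic.path_concat hQ hP hadj (P.getVert_mem_support _)
  have hl := congrArg Walk.length hPQ
  rw [Walk.length_concat] at hl
  have hxQ : x ∉ Q.support := by
    rw [hPQ] at hP
    exact ((Walk.concat_isPath_iff hadj).1 hP).2
  refine ⟨P.penultimate, hadj, by omega, fun q hq hd => ?_, ?_, ?_⟩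
  · exact hG.isAcyclic.eq_penultimate_of_adj_end hP hq.symm (key q hq hd)
  · rw [hG.isAcyclic.seg_eq_support hP, hG.isAcyclic.seg_eq_support hQ]
    ext z
    have : z ∈ P.support ↔ z ∈ (Q.concat hadj).support := by rw [← hPQ]
    simp [this, Walk.support_concat, or_comm]
  · rw [hG.isAcyclic.seg_eq_support hQ]
    exact hxQ

lemma outerBoundary_singleton (x : V) : G.outerBoundary {x} = G.neighborSet x := by
  ext c
  simp only [outerBoundary, Set.mem_singleton_iff, exists_eq_left, Set.mem_ofPred_eq,
    mem_neighborSet, and_iff_right_iff_imp]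
  rintro h rfl
  exact h.ne rfl

lemma IsTree.outerBoundary_nonempty (hG : G.IsTree) {S : Set V} (hS : S.Nonempty)
    (hne : S ≠ Set.univ) : (G.outerBoundary S).Nonempty := by
  obtain ⟨a, ha⟩ := hS
  obtain ⟨b, hb⟩ := (Set.ne_univ_iff_exists_notMem S).1 hne
  obtain ⟨p⟩ := hG.connected.preconnected a b
  obtain ⟨d, -, h1, h2⟩ := p.exists_boundary_dart S ha hb
  exact ⟨d.snd, h2, d.fst, h1, d.adj⟩

lemma ncard_outerBoundary_univ : (G.outerBoundary Set.univ).ncard = 0 := by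
  simp [outerBoundary]

/-- Adding a vertex with a neighbor in a connected set `P` changes the size of the boundary by its
degree minus two. -/
lemma IsTree.ncard_outerBoundary_insert [Finite V] (hG : G.IsTree) {P : Set V} {x p : V}
    (hP : (G.induce P).Preconnected) (hP' : (G.induce (insert x P)).Preconnected)
    (hx : x ∉ P) (hp : p ∈ P) (hpx : G.Adj p x) :
    (G.outerBoundary (insert x P)).ncard + 2 =
      (G.outerBoundary P).ncard + (G.neighborSet x).ncard := by
  have h1 : G.outerBoundary (insert x P) = (G.outerBoundary P \ {x}) ∪ (G.neighborSet x \ {p}) := by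
    ext c
    constructor
    · rintro ⟨hc, a, ha, hac⟩
      rw [Set.mem_insert_iff, not_or] at hc
      rcases ha with rfl | ha
      · exact .inr ⟨hac, fun h => hc.2 (h ▸ hp)⟩
      · exact .inl ⟨⟨hc.2, a, ha, hac⟩, hc.1⟩
    · rintro (⟨⟨hc, a, ha, hac⟩, hcx⟩ | ⟨hc, hcp⟩)
      · exact ⟨by simp_all, a, .inr ha, hac⟩
      · refine ⟨?_, x, .inl rfl, hc⟩
        rintro (rfl | hcP)
        · exact G.irrefl hc
        · exact hcp (hG.isAcyclic.eq_of_adj_of_preconnected hP hcP hp hx hc.symm hpx)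
  have hdisj : Disjoint (G.outerBoundary P \ {x}) (G.neighborSet x \ {p}) := by
    rw [Set.disjoint_left]
    rintro c ⟨⟨hc, a, ha, hac⟩, hcx⟩ ⟨hc', -⟩
    have := hG.isAcyclic.eq_of_adj_of_preconnected hP' (.inr ha) (.inl rfl)
      (by rintro (h | h); exacts [hcx h, hc h]) hac hc'
    exact hx (this ▸ ha)
  have h2 := Set.ncard_sdiff_singleton_add_one (a := x) (s := G.outerBoundary P) ⟨hx, p, hp, hpx⟩
  have h3 := Set.ncard_sdiff_singleton_add_one (a := p) (s := G.neighborSet x) hpx.symm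
  rw [h1, Set.ncard_union_eq hdisj]
  omega

lemma IsTree.ncard_outerBoundary_seg [Finite V] (hG : G.IsTree) {x y p : V} (hpx : G.Adj p x)
    (hseg : G.seg y x = insert x (G.seg y p)) (hx : x ∉ G.seg y p) :
    (G.outerBoundary (G.seg y x)).ncard + 2 =
      (G.outerBoundary (G.seg y p)).ncard + (G.neighborSet x).ncard := by
  have h := (hG.connected_induce_seg y x).preconnected
  rw [hseg] at h ⊢
  exact hG.ncard_outerBoundary_insert (hG.connected_induce_seg y p).preconnected h hx
    (right_mem_seg _ _) hpx

/-- Summation over the edges of a tree, directed away from `y`. -/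
theorem IsTree.sum_mul_card_children [Fintype V] [DecidableEq V] (hG : G.IsTree) (y : V)
    (g r : V → ℚ)
    (hr : ∀ x p, G.Adj p x → G.seg y x = insert x (G.seg y p) → x ∉ G.seg y p → r x = g p) :
    ∑ x, g x * ((G.neighborSet x).ncard - if x = y then 0 else 1) =
      ∑ x, if x = y then 0 else r x := by
  classical
  let R : V → V → Prop := fun x c => G.Adj x c ∧ G.dist y c = G.dist y x + 1
  trans ∑ x, ∑ c, if R x c then g x else 0
  · refine Finset.sum_congr rfl fun x _ => ?_
    rw [Finset.sum_ite, Finset.sum_const_zero, add_zero, Finset.sum_const, nsmul_eq_mul, mul_comm]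
    congr 1
    have h2 : (Finset.univ.filter (R x)).card = {c | R x c}.ncard := by
      rw [← Set.ncard_coe_finset]; congr 1; ext; simp
    rw [h2]
    split_ifs with hxy
    · subst hxy
      rw [sub_zero]
      congr 2
      ext c
      simp only [R, Set.mem_ofPred_eq, mem_neighborSet, dist_self]
      refine ⟨fun h => ⟨h, by simpa using dist_eq_one_iff_adj.2 h⟩, And.left⟩
    · obtain ⟨p, hp, hd, huniq, -⟩ := hG.exists_parent hxy
      have : {c | R x c} = G.neighborSet x \ {p} := by
        ext c
        constructor
        · rintro ⟨h1, h2⟩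
          exact ⟨h1, by rintro rfl; omega⟩
        · rintro ⟨h1, h2⟩
          refine ⟨h1, ?_⟩
          rcases hG.dist_eq_dist_add_one_of_adj y h1 with h | h
          · exact absurd (huniq c h1.symm h) h2
          · exact h
      rw [this, ← Set.ncard_sdiff_singleton_add_one (a := p) (s := G.neighborSet x) hp.symm]
      push_cast; ring
  · rw [Finset.sum_comm]
    refine Finset.sum_congr rfl fun c _ => ?_
    split_ifs with hcy
    · subst hcy
      refine Finset.sum_eq_zero fun x _ => if_neg ?_
      rintro ⟨-, h⟩
      simp at h
    · obtain ⟨p, hp, hd, huniq, hseg, hc⟩ := hG.exists_parent hcy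
      rw [Finset.sum_eq_single p, if_pos ⟨hp, hd⟩, hr c p hp hseg hc]
      · intro b _ hb
        exact if_neg fun h => hb (huniq b h.1 h.2)
      · simp

/-- Summation of an alternating function against a function that satisfies a local balance
condition away from `y`. -/
theorem IsTree.sum_alternating_mul [Fintype V] (hG : G.IsTree) {s : V → ℚ}
    (hs : ∀ a b, G.Adj a b → s a = -s b) (y : V) (g : V → ℚ)
    (hg : ∀ x p, G.Adj p x → G.seg y x = insert x (G.seg y p) → x ∉ G.seg y p →
      g x = g p / 2 + g x * ((G.neighborSet x).ncard - 1) / 2) :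
    ∑ x, s x * g x = s y * g y * (1 - (G.neighborSet y).ncard / 2) := by
  classical
  have h := hG.sum_mul_card_children y (fun x => s x * g x)
    (fun x => s x * (g x * ((G.neighborSet x).ncard - 1) - 2 * g x)) (by
      intro x p hp hseg hx
      rw [hs p x hp]
      linear_combination (-2 * s x) * hg x p hp hseg hx)
  have h3 : ∑ x, (if x = y then s y * g y * (1 - (G.neighborSet y).ncard / 2) else 0) =
      s y * g y * (1 - (G.neighborSet y).ncard / 2) := by simp
  rw [← h3, ← sub_eq_zero, ← Finset.sum_sub_distrib]
  rw [← sub_eq_zero, ← Finset.sum_sub_distrib] at h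
  refine (mul_eq_zero.1 (Eq.trans ?_ h)).resolve_left (two_ne_zero (α := ℚ))
  rw [Finset.mul_sum]
  refine Finset.sum_congr rfl fun x _ => ?_
  split_ifs with hx
  · subst hx; ring
  · ring

lemma IsTree.sum_degree [Fintype V] (hG : G.IsTree) :
    ∑ x, ((G.neighborSet x).ncard : ℚ) = 2 * (Fintype.card V - 1) := by
  classical
  obtain ⟨y⟩ := hG.connected.nonempty
  have h := hG.sum_mul_card_children y (fun _ => 1) (fun _ => 1) (by simp)
  have h2 : ∑ x : V, (if x = y then (0 : ℚ) else 1) = Fintype.card V - 1 := by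
    have : ∀ x : V, (if x = y then (0 : ℚ) else 1) = 1 - if x = y then 1 else 0 := by
      intro x; split_ifs <;> simp
    simp [this]
  simp only [one_mul, Finset.sum_sub_distrib, h2] at h
  linarith

lemma IsTree.sum_alternating_mul_degree [Fintype V] (hG : G.IsTree) {s : V → ℚ}
    (hs : ∀ a b, G.Adj a b → s a = -s b) : ∑ x, s x * (G.neighborSet x).ncard = 0 := by
  classical
  obtain ⟨y⟩ := hG.connected.nonempty
  have h := hG.sum_mul_card_children y s (fun x => -s x) (fun x p hp _ _ => (hs p x hp).symm)
  rw [← sub_eq_zero, ← Finset.sum_sub_distrib] at h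
  rw [← h]
  refine Finset.sum_congr rfl fun x _ => ?_
  split_ifs <;> ring

end SimpleGraph

namespace SimpleGraph

variable {V : Type u} {G : SimpleGraph V}

/-- An edge of a tree that leads from the side of `y` to the side of `x` of the edge `xy` is that
edge. -/
lemma IsTree.eq_of_crossing (hG : G.IsTree) {x y a b : V} (hxy : G.Adj x y) (hab : G.Adj a b)
    (ha : G.dist a y < G.dist a x) (hb : G.dist b x < G.dist b y) : a = y ∧ b = x := by
  have h1 := hG.dist_eq_dist_add_one_of_adj a hxy
  have h2 := hG.dist_eq_dist_add_one_of_adj b hxy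
  have h3 := hG.dist_eq_dist_add_one_of_adj x hab
  have h4 := hG.dist_eq_dist_add_one_of_adj y hab
  rw [dist_comm (u := x) (v := a), dist_comm (u := x) (v := b)] at h3
  rw [dist_comm (u := y) (v := a), dist_comm (u := y) (v := b)] at h4
  have hm : G.dist b x = G.dist a y := by omega
  suffices h : G.dist a y = 0 by
    rw [h] at hm
    exact ⟨hG.connected.dist_eq_zero_iff.1 h, hG.connected.dist_eq_zero_iff.1 hm⟩
  by_contra h0
  have hxb : x ≠ b := by
    rintro rfl
    rw [dist_self] at hm
    exact h0 hm.symm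
  have hxa : x ≠ a := by
    rintro rfl
    rw [dist_self] at ha
    omega
  obtain ⟨q, hq, hqd, -⟩ := hG.exists_parent hxb
  obtain ⟨p, -, -, huniq, -⟩ := hG.exists_parent hxa
  have hd := hG.connected.dist_triangle (u := a) (v := b) (w := q)
  rw [dist_eq_one_iff_adj.2 hab] at hd
  have hd' := hG.dist_eq_dist_add_one_of_adj a hq
  have e1 := huniq q hq (by omega)
  have e2 := huniq y hxy.symm (by omega)
  rw [e2, ← e1] at hb
  omega

/-- A fixed point free automorphism of a finite tree inverts an edge. -/
theorem IsTree.exists_inverted_edge [Finite V] (hG : G.IsTree) (φ : G ≃g G)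
    (hφ : ∀ x, φ x ≠ x) : ∃ x y, G.Adj x y ∧ φ x = y ∧ φ y = x := by
  classical
  have := Fintype.ofFinite V
  choose p hp hd _ using fun x => hG.exists_parent (hφ x).symm
  have hcard := hG.card_edgeFinset
  obtain ⟨x, -, y, -, hne, he⟩ := Finset.exists_ne_map_eq_of_card_lt_of_maps_to
    (s := (Finset.univ : Finset V)) (t := G.edgeFinset) (f := fun x => s(p x, x))
    (by rw [Finset.card_univ]; omega) (fun x _ => by simpa using hp x)
  rw [Sym2.eq_iff] at he
  rcases he with ⟨-, h⟩ | ⟨h1, h2⟩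
  · exact absurd h hne
  · have hx := hd x
    have hy := hd y
    rw [h1] at hx
    rw [← h2] at hy
    have hxy : G.Adj x y := by simpa [h1] using (hp x).symm
    obtain ⟨e1, e2⟩ := hG.eq_of_crossing hxy (φ.map_adj_iff.2 hxy) (by omega) (by omega)
    exact ⟨x, y, hxy, e1, e2⟩

lemma Iso.dist_apply (φ : G ≃g G) (x y : V) : G.dist (φ x) (φ y) = G.dist x y := by
  have key : ∀ (ψ : G ≃g G) (a b : V), G.dist (ψ a) (ψ b) ≤ G.dist a b ∨ ¬ G.Reachable a b := by
    intro ψ a b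
    by_cases h : G.Reachable a b
    · obtain ⟨p, hp⟩ := h.exists_walk_length_eq_dist
      left
      rw [← hp, ← Walk.length_map ψ.toHom p]
      exact dist_le _
    · exact .inr h
  by_cases h : G.Reachable x y
  · have h1 := (key φ x y).resolve_right (not_not.2 h)
    have h2 := (key φ.symm (φ x) (φ y)).resolve_right (not_not.2 (h.map φ.toHom))
    simp only [RelIso.symm_apply_apply] at h2
    omega
  · rw [dist_eq_zero_of_not_reachable h, dist_eq_zero_of_not_reachable]
    intro h'
    exact h (by simpa using h'.map φ.symm.toHom)

end SimpleGraph

namespace RootedGraph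

open SimpleGraph

variable {t : RootedGraph.{u}}

/-- The part of a tree on the side of `x` of an edge `xy`, rooted at `x`. -/
def halfTree (t : RootedGraph.{u}) (x y : t.V) (h : t.graph.Adj x y) : RootedGraph.{u} where
  V := {z // t.graph.dist z x < t.graph.dist z y}
  finite := inferInstance
  graph := t.graph.induce {z | t.graph.dist z x < t.graph.dist z y}
  root := ⟨x, by rw [dist_self, dist_eq_one_iff_adj.2 h]; exact Nat.one_pos⟩

lemma IsTree.halfTree (ht : t.IsTree) {x y : t.V} (h : t.graph.Adj x y) :
    (t.halfTree x y h).IsTree := by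
  have ht' : t.graph.IsTree := ht
  refine ⟨?_, ht'.isAcyclic.induce _⟩
  have key : ∀ (n : ℕ) (z : (t.halfTree x y h).V), t.graph.dist x z.1 = n →
      (t.halfTree x y h).graph.Reachable (t.halfTree x y h).root z := by
    intro n
    induction n using Nat.strong_induction_on with
    | _ n ih =>
      intro z hz
      by_cases hzx : z.1 = x
      · have : z = (t.halfTree x y h).root := Subtype.ext hzx
        rw [this]
      · obtain ⟨q, hq, hd, -⟩ := ht'.exists_parent hzx
        have h1 := z.2
        have h2 := ht'.dist_eq_dist_add_one_of_adj y hq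
        rw [dist_comm (u := y) (v := q), dist_comm (u := y) (v := z.1)] at h2
        rw [dist_comm (u := x) (v := q)] at hd
        rw [dist_comm (v := x)] at h1
        have hqA : t.graph.dist q x < t.graph.dist q y := by omega
        have hlt : t.graph.dist x q < n := by rw [dist_comm]; omega
        exact (ih _ hlt ⟨q, hqA⟩ rfl).trans (Adj.reachable hq)
  have : Nonempty (t.halfTree x y h).V := ⟨(t.halfTree x y h).root⟩
  refine ⟨fun a b => (key _ a rfl).symm.trans (key _ b rfl)⟩

lemma IsTree.rootEquiv_butcher (ht : t.IsTree) (φ : t.graph ≃g t.graph) {x y : t.V}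
    (h : t.graph.Adj x y) (hx : φ x = y) (hy : φ y = x) :
    t.RootEquiv ((t.halfTree x y h).butcher (t.halfTree x y h)) := by
  have ht' : t.graph.IsTree := ht
  have hdist : ∀ z, (t.graph.dist (φ z) y < t.graph.dist (φ z) x ↔
      t.graph.dist z x < t.graph.dist z y) := by
    intro z
    rw [← φ.dist_apply z x, ← φ.dist_apply z y, hx, hy]
  have hside : ∀ z, t.graph.dist z x < t.graph.dist z y ∨ t.graph.dist z y < t.graph.dist z x := by
    intro z
    have := ht'.dist_ne_of_adj z h
    omega
  let f : (t.halfTree x y h).V ⊕ (t.halfTree x y h).V → t.V :=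
    Sum.elim (fun z => z.1) (fun z => φ z.1)
  have hf : Function.Bijective f := by
    constructor
    · rintro (a | a) (b | b) hab
      · exact congrArg _ (Subtype.ext hab)
      · have h1 := a.2
        have h2 := (hdist b.1).2 b.2
        have h3 : a.1 = φ b.1 := hab
        rw [h3] at h1
        omega
      · have h1 := b.2
        have h2 := (hdist a.1).2 a.2
        have h3 : φ a.1 = b.1 := hab
        rw [← h3] at h1
        omega
      · exact congrArg _ (Subtype.ext (φ.injective hab))
    · intro z
      rcases hside z with hz | hz
      · exact ⟨.inl ⟨z, hz⟩, rfl⟩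
      · refine ⟨.inr ⟨φ.symm z, (hdist _).1 (by simpa using hz)⟩, ?_⟩
        exact φ.apply_symm_apply z
  have hcross : ∀ a b : (t.halfTree x y h).V, t.graph.Adj a.1 (φ b.1) ↔
      a = (t.halfTree x y h).root ∧ b = (t.halfTree x y h).root := by
    intro a b
    constructor
    · intro hab
      obtain ⟨e1, e2⟩ := ht'.eq_of_crossing h hab.symm ((hdist _).2 b.2) a.2
      exact ⟨Subtype.ext e2, Subtype.ext (φ.injective (e1.trans hx.symm))⟩
    · rintro ⟨rfl, rfl⟩
      change t.graph.Adj x (φ x)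
      rwa [hx]
  refine ⟨(RelIso.mk (Equiv.ofBijective f hf) ?_ :
    ((t.halfTree x y h).butcher (t.halfTree x y h)).graph ≃g t.graph).symm⟩
  rintro (a | a) (b | b)
  · rfl
  · exact hcross a b
  · exact (t.graph.adj_comm _ _).trans (hcross b a)
  · exact φ.map_adj_iff

/-- Automorphisms of an admissible tree preserve the parity of the labels. -/
theorem Admissible.sign_apply (ht : t.Admissible) {s : t.V → ℚ}
    (hs : ∀ a b, t.graph.Adj a b → s a = -s b) (φ : t.graph ≃g t.graph) (x : t.V) :
    s (φ x) = s x := by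
  by_cases h : ∃ z, φ z = z
  · obtain ⟨z, hz⟩ := h
    obtain ⟨p⟩ := ht.1.connected.preconnected x z
    induction p with
    | nil => rw [hz]
    | cons hadj _ ih => rw [hs _ _ hadj, hs _ _ (φ.map_adj_iff.2 hadj), ih hz]
  · push Not at h
    have ht' : t.graph.IsTree := ht.1
    obtain ⟨a, b, hab, h1, h2⟩ := ht'.exists_inverted_edge φ h
    exact absurd (ht.1.rootEquiv_butcher φ hab h1 h2) (ht.2.2 _ (ht.1.halfTree hab))

end RootedGraph

namespace RootedGraph

open SimpleGraph

/-- Root preserving isomorphisms. -/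
abbrev RootIso (s t : RootedGraph.{u}) : Type u :=
  {φ : s.graph ≃g t.graph // φ s.root = t.root}

instance (s t : RootedGraph.{u}) : Finite (s.graph ≃g t.graph) :=
  Finite.of_injective (fun φ : s.graph ≃g t.graph => (φ : s.V → t.V)) DFunLike.coe_injective

lemma card_rootIso_of_properIso {s t : RootedGraph.{u}} (h : ProperIso s t) :
    Nat.card (RootIso s t) = Nat.card (RootIso s s) := by
  obtain ⟨φ, hφ⟩ := h
  refine Nat.card_congr
    { toFun := fun ψ => ⟨φ.symm.comp ψ.1, ?_⟩
      invFun := fun ψ => ⟨φ.comp ψ.1, ?_⟩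
      left_inv := ?_
      right_inv := ?_ }
  · change φ.symm (ψ.1 s.root) = s.root
    rw [ψ.2, ← hφ, RelIso.symm_apply_apply]
  · change φ (ψ.1 s.root) = t.root
    rw [ψ.2, hφ]
  · intro ψ
    ext x
    exact φ.apply_symm_apply _
  · intro ψ
    ext x
    exact φ.symm_apply_apply _

lemma card_rootIso_of_not_properIso {s t : RootedGraph.{u}} (h : ¬ ProperIso s t) :
    Nat.card (RootIso s t) = 0 := by
  have : IsEmpty (RootIso s t) := ⟨fun φ => h ⟨φ.1, φ.2⟩⟩
  exact Nat.card_of_isEmpty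

variable {t : RootedGraph.{u}}

lemma root_notMem_branchVerts (c : t.V) : t.root ∉ t.branchVerts c := by
  rintro ⟨p, hp⟩
  exact hp p.end_mem_support

lemma ne_root_of_mem_branchVerts {c x : t.V} (hx : x ∈ t.branchVerts c) : x ≠ t.root := by
  rintro rfl
  exact root_notMem_branchVerts c hx

lemma child_mem_branchVerts (c : t.Children) : c.1 ∈ t.branchVerts c.1 :=
  ⟨.nil, by simpa using c.2.ne⟩

lemma branchVerts_of_adj {c : t.V} {x y : t.V} (hx : x ∈ t.branchVerts c) (hxy : t.graph.Adj x y)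
    (hy : y ≠ t.root) : y ∈ t.branchVerts c := by
  obtain ⟨p, hp⟩ := hx
  refine ⟨p.concat hxy, ?_⟩
  rw [Walk.support_concat]
  simp [hp, hy.symm]

lemma IsTree.exists_mem_branchVerts (ht : t.IsTree) {x : t.V} (hx : x ≠ t.root) :
    ∃ c : t.Children, x ∈ t.branchVerts c.1 := by
  obtain ⟨p, hp, -⟩ := SimpleGraph.IsTree.existsUnique_path ht t.root x
  cases p with
  | nil => exact absurd rfl hx
  | cons h q => exact ⟨⟨_, h⟩, q, ((Walk.cons_isPath_iff h q).1 hp).2⟩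

lemma IsTree.child_unique (ht : t.IsTree) {c d : t.Children} {x : t.V}
    (hc : x ∈ t.branchVerts c.1) (hd : x ∈ t.branchVerts d.1) : c = d := by
  have ht' : t.graph.IsTree := ht
  obtain ⟨p, hp⟩ := hc
  obtain ⟨q, hq⟩ := hd
  refine Subtype.ext (ht'.isAcyclic.eq_of_adj_of_preconnected
    (p.append q.reverse).connected_induce_support.preconnected
    (Walk.start_mem_support _) (Walk.end_mem_support _) (c := t.root) ?_ c.2.symm d.2.symm)
  simpa [Walk.mem_support_append_iff] using ⟨hp, hq⟩

lemma IsTree.eq_of_adj_branchVerts (ht : t.IsTree) {c d : t.Children} {x y : t.V}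
    (hx : x ∈ t.branchVerts c.1) (hy : y ∈ t.branchVerts d.1) (h : t.graph.Adj x y) : c = d :=
  ht.child_unique (branchVerts_of_adj hx h (ne_root_of_mem_branchVerts hy)) hy

lemma IsTree.eq_child_of_adj (ht : t.IsTree) {c : t.Children} {x : t.V}
    (hx : x ∈ t.branchVerts c.1) (h : t.graph.Adj t.root x) : x = c.1 :=
  congrArg Subtype.val (ht.child_unique (child_mem_branchVerts ⟨x, h⟩) hx)

lemma IsTree.branch (ht : t.IsTree) (c : t.Children) : (t.branch c).IsTree := by
  have ht' : t.graph.IsTree := ht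
  refine ⟨?_, ht'.isAcyclic.induce _⟩
  have key : ∀ x : (t.branch c).V, (t.branch c).graph.Reachable (t.branch c).root x := by
    rintro ⟨x, p, hp⟩
    have hs : ∀ z ∈ p.support, z ∈ t.branchVerts c.1 := by
      classical
      intro z hz
      exact ⟨p.takeUntil z hz, fun h => hp (p.support_takeUntil_subset_support hz h)⟩
    exact ⟨p.induce _ hs⟩
  have : Nonempty (t.branch c).V := ⟨(t.branch c).root⟩
  exact ⟨fun a b => (key a).symm.trans (key b)⟩

/-- The vertices of a tree are the root and the vertices of the branches. -/
noncomputable def IsTree.vertEquiv (ht : t.IsTree) :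
    Option (Σ c : t.Children, (t.branch c).V) ≃ t.V :=
  Equiv.ofBijective (fun o => o.elim t.root fun x => x.2.1) <| by
    constructor
    · rintro (_ | ⟨c, x⟩) (_ | ⟨d, y⟩) h
      · rfl
      · exact absurd h.symm (ne_root_of_mem_branchVerts y.2)
      · exact absurd h (ne_root_of_mem_branchVerts x.2)
      · obtain ⟨x, hx⟩ := x
        obtain ⟨y, hy⟩ := y
        obtain rfl : x = y := h
        obtain rfl := ht.child_unique hx hy
        rfl
    · intro x
      by_cases hx : x = t.root
      · exact ⟨none, hx.symm⟩
      · obtain ⟨c, hc⟩ := ht.exists_mem_branchVerts hx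
        exact ⟨some ⟨c, x, hc⟩, rfl⟩

lemma map_branchVerts (φ : RootIso t t) {c x : t.V} (hx : x ∈ t.branchVerts c) :
    φ.1 x ∈ t.branchVerts (φ.1 c) := by
  obtain ⟨p, hp⟩ := hx
  refine ⟨p.map φ.1.toHom, ?_⟩
  rw [Walk.support_map, List.mem_map]
  rintro ⟨z, hz, h⟩
  have : φ.1 z = φ.1 t.root := h.trans φ.2.symm
  exact hp (φ.1.injective this ▸ hz)

lemma map_branchVerts_iff (φ : RootIso t t) {c x : t.V} :
    φ.1 x ∈ t.branchVerts (φ.1 c) ↔ x ∈ t.branchVerts c := by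
  refine ⟨fun h => ?_, map_branchVerts φ⟩
  have := map_branchVerts ⟨φ.1.symm, by rw [RelIso.symm_apply_eq]; exact φ.2.symm⟩ h
  simpa using this

/-- The permutation of the children of the root induced by a root preserving automorphism. -/
def childPerm (φ : RootIso t t) : Equiv.Perm t.Children :=
  φ.1.toEquiv.subtypeEquiv fun c => by
    change _ ↔ t.graph.Adj t.root (φ.1 c)
    rw [← φ.1.map_adj_iff, φ.2]

/-- The restriction of a root preserving automorphism to a branch. -/
def branchRestrict (φ : RootIso t t) (c d : t.Children) (h : φ.1 c.1 = d.1) :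
    RootIso (t.branch c) (t.branch d) :=
  ⟨⟨φ.1.toEquiv.subtypeEquiv fun x => by
      change x ∈ t.branchVerts c.1 ↔ φ.1 x ∈ t.branchVerts d.1
      rw [← h]; exact (map_branchVerts_iff φ).symm,
    φ.1.map_adj_iff⟩, Subtype.ext h⟩

/-- Root preserving automorphisms that induce a given permutation of the children are families of
isomorphisms between branches. -/
lemma IsTree.card_childPerm_fiber (ht : t.IsTree) (π : Equiv.Perm t.Children) :
    Nat.card {φ : RootIso t t // childPerm φ = π} =
      Nat.card (∀ c, RootIso (t.branch c) (t.branch (π c))) := by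
  have hval : ∀ (φ : {φ : RootIso t t // childPerm φ = π}) (c : t.Children),
      φ.1.1 c.1 = (π c).1 := by
    rintro ⟨φ, rfl⟩ c
    rfl
  refine Nat.card_congr (Equiv.ofBijective
    (fun φ c => branchRestrict φ.1 c (π c) (hval φ c)) ⟨?_, ?_⟩)
  · intro φ ψ h
    ext x
    by_cases hx : x = t.root
    · rw [hx, φ.1.2, ψ.1.2]
    · obtain ⟨c, hc⟩ := ht.exists_mem_branchVerts hx
      have := congrFun h c
      exact congrArg (fun θ : RootIso (t.branch c) (t.branch (π c)) => (θ.1 ⟨x, hc⟩).1) this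
  · intro θ
    let K : Option (Σ c : t.Children, (t.branch c).V) ≃ Option (Σ c : t.Children, (t.branch c).V) :=
      Equiv.optionCongr (Equiv.sigmaCongr π fun c => (θ c).1.toEquiv)
    have hroot : ∀ (c : t.Children) (x : (t.branch c).V),
        t.graph.Adj t.root x.1 ↔ x = (t.branch c).root := by
      intro c x
      refine ⟨fun h => Subtype.ext (ht.eq_child_of_adj x.2 h), ?_⟩
      rintro rfl
      exact c.2
    have hθroot : ∀ (c : t.Children) (x : (t.branch c).V),
        (θ c).1 x = (t.branch (π c)).root ↔ x = (t.branch c).root := by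
      intro c x
      exact ⟨fun h => (θ c).1.injective (h.trans (θ c).2.symm), fun h => h ▸ (θ c).2⟩
    have hadj : ∀ a b, t.graph.Adj (ht.vertEquiv (K a)) (ht.vertEquiv (K b)) ↔
        t.graph.Adj (ht.vertEquiv a) (ht.vertEquiv b) := by
      rintro (_ | ⟨c, x⟩) (_ | ⟨d, y⟩)
      · exact Iff.rfl
      · change t.graph.Adj t.root ((θ d).1 y).1 ↔ t.graph.Adj t.root y.1
        rw [hroot, hroot, hθroot]
      · change t.graph.Adj ((θ c).1 x).1 t.root ↔ t.graph.Adj x.1 t.root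
        rw [t.graph.adj_comm, hroot, t.graph.adj_comm, hroot, hθroot]
      · change t.graph.Adj ((θ c).1 x).1 ((θ d).1 y).1 ↔ t.graph.Adj x.1 y.1
        by_cases hcd : c = d
        · subst hcd
          exact (θ c).1.map_adj_iff
        · constructor
          · intro h
            exact absurd (π.injective (ht.eq_of_adj_branchVerts ((θ c).1 x).2 ((θ d).1 y).2 h)) hcd
          · intro h
            exact absurd (ht.eq_of_adj_branchVerts x.2 y.2 h) hcd
    let φ : t.graph ≃g t.graph := ⟨(ht.vertEquiv.symm.trans K).trans ht.vertEquiv, by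
      intro a b
      have := hadj (ht.vertEquiv.symm a) (ht.vertEquiv.symm b)
      rw [ht.vertEquiv.apply_symm_apply, ht.vertEquiv.apply_symm_apply] at this
      exact this⟩
    have hφ : ∀ o, φ (ht.vertEquiv o) = ht.vertEquiv (K o) := by
      intro o
      change ht.vertEquiv (K (ht.vertEquiv.symm (ht.vertEquiv o))) = _
      rw [ht.vertEquiv.symm_apply_apply]
    have hφx : ∀ (c : t.Children) (x : (t.branch c).V), φ x.1 = ((θ c).1 x).1 :=
      fun c x => hφ (some ⟨c, x⟩)
    refine ⟨⟨⟨φ, hφ none⟩, ?_⟩, ?_⟩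
    · ext c
      refine (hφx c (t.branch c).root).trans ?_
      rw [(θ c).2]
      rfl
    · funext c
      exact Subtype.ext (DFunLike.ext _ _ fun x => Subtype.ext (hφx c x))

theorem IsTree.card_rootIso (ht : t.IsTree) :
    Nat.card (RootIso t t) =
      Nat.card {π : Equiv.Perm t.Children // ∀ c, ProperIso (t.branch c) (t.branch (π c))} *
        ∏ᶠ c : t.Children, Nat.card (RootIso (t.branch c) (t.branch c)) := by
  classical
  have := Fintype.ofFinite t.Children
  rw [Nat.card_congr (Equiv.sigmaFiberEquiv (childPerm (t := t))).symm, Nat.card_sigma,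
    finprod_eq_prod_of_fintype]
  have h : ∀ π : Equiv.Perm t.Children, Nat.card {φ : RootIso t t // childPerm φ = π} =
      if ∀ c, ProperIso (t.branch c) (t.branch (π c)) then
        ∏ c : t.Children, Nat.card (RootIso (t.branch c) (t.branch c)) else 0 := by
    intro π
    rw [ht.card_childPerm_fiber, Nat.card_pi]
    split_ifs with hπ
    · exact Finset.prod_congr rfl fun c _ => card_rootIso_of_properIso (hπ c)
    · push Not at hπ
      obtain ⟨c, hc⟩ := hπ
      exact Finset.prod_eq_zero (Finset.mem_univ c) (card_rootIso_of_not_properIso hc)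
  rw [Finset.sum_congr rfl fun π _ => h π, Finset.sum_ite, Finset.sum_const_zero, add_zero,
    Finset.sum_const, smul_eq_mul, Nat.card_eq_fintype_card, Fintype.card_subtype]

/-- The symmetry coefficient of a tree counts its root preserving automorphisms. -/
theorem IsTree.sigma_eq (ht : t.IsTree) : t.sigma = Nat.card (RootIso t t) := by
  classical
  induction h : Nat.card t.V using Nat.strong_induction_on generalizing t with
  | _ n ih =>
    let _ := Fintype.ofFinite t.Children
    let _ := Fintype.ofFinite (Quotient t.childSetoid)
    rw [sigma, ht.card_rootIso, mul_comm, finprod_eq_prod_of_fintype]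
    congr 1
    · have hst := DomMulAct.stabilizer_ncard (Quotient.mk t.childSetoid)
      rw [← Nat.card_coe_set_eq] at hst
      refine Eq.trans ?_ (hst.symm.trans (Nat.card_congr (Equiv.subtypeEquivRight ?_)))
      · rfl
      · intro π
        rw [Set.mem_ofPred_eq, funext_iff]
        refine forall_congr' fun c => ?_
        rw [Function.comp_apply, Quotient.eq]
        exact ⟨fun h => t.childSetoid.symm h, fun h => t.childSetoid.symm h⟩
    · refine Finset.prod_congr rfl fun c _ => ih _ ?_ (ht.branch c) rfl
      exact h ▸ t.card_branch_lt c

end RootedGraph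

namespace RootedGraph

open SimpleGraph

variable {t : RootedGraph.{u}}

lemma IsTree.isTall_branch_iff (ht : t.IsTree) :
    (∀ c : t.Children, (t.branch c).IsTall) ↔ ∀ x, x ≠ t.root → t.deg x ≤ 2 := by
  have himg : ∀ (c : t.Children) (x : (t.branch c).V),
      Subtype.val '' ((t.branch c).graph.neighborSet x) = t.graph.neighborSet x.1 \ {t.root} := by
    intro c x
    ext y
    constructor
    · rintro ⟨y, hy, rfl⟩
      exact ⟨hy, ne_root_of_mem_branchVerts y.2⟩
    · rintro ⟨hy, hyr⟩
      exact ⟨⟨y, branchVerts_of_adj x.2 hy hyr⟩, hy, rfl⟩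
  have hdeg : ∀ (c : t.Children) (x : (t.branch c).V),
      (t.branch c).deg x = (t.graph.neighborSet x.1 \ {t.root}).ncard := by
    intro c x
    exact (Set.ncard_image_of_injective _ Subtype.val_injective).symm.trans
      (congrArg Set.ncard (himg c x))
  have hroot : ∀ c : t.Children, (t.branch c).deg (t.branch c).root + 1 = t.deg c.1 := by
    intro c
    rw [hdeg]
    exact Set.ncard_sdiff_singleton_add_one (a := t.root) (s := t.graph.neighborSet c.1) c.2.symm
  constructor
  · intro h x hx
    obtain ⟨c, hc⟩ := ht.exists_mem_branchVerts hx
    obtain ⟨-, h2, h1⟩ := h c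
    by_cases hxc : t.graph.Adj t.root x
    · have e := ht.eq_child_of_adj hc hxc
      have := hroot c
      rw [e, ← this]
      exact Nat.succ_le_succ h1
    · have := (hdeg c ⟨x, hc⟩).symm.trans_le (h2 ⟨x, hc⟩)
      have hr : t.root ∉ t.graph.neighborSet x := fun h => hxc (Adj.symm h)
      rwa [deg, ← Set.sdiff_singleton_eq_self hr]
  · intro h c
    refine ⟨ht.branch c, fun x => ?_, ?_⟩
    · rw [hdeg]
      refine (Set.ncard_le_ncard Set.sdiff_subset).trans (h x.1 (ne_root_of_mem_branchVerts x.2))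
    · have := hroot c
      have h2 := h c.1 c.2.ne'
      change (t.branch c).deg (t.branch c).root ≤ 1
      omega

/-- The contraction map. -/
noncomputable def contractMap (t : RootedGraph.{u}) (w : Set t.V) (x : t.V) :
    (t.contract w).V :=
  open Classical in if h : x ∈ w then none else some ⟨x, h⟩

lemma contractMap_of_mem {w : Set t.V} {x : t.V} (h : x ∈ w) : t.contractMap w x = none :=
  dif_pos h

lemma contractMap_of_notMem {w : Set t.V} {x : t.V} (h : x ∉ w) :
    t.contractMap w x = some ⟨x, h⟩ :=
  dif_neg h

lemma contractMap_eq_iff {w : Set t.V} {x y : t.V} :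
    t.contractMap w x = t.contractMap w y ↔ x = y ∨ (x ∈ w ∧ y ∈ w) := by
  by_cases hx : x ∈ w <;> by_cases hy : y ∈ w
  · exact iff_of_true ((contractMap_of_mem hx).trans (contractMap_of_mem hy).symm) (.inr ⟨hx, hy⟩)
  · simp only [contractMap_of_mem hx, contractMap_of_notMem hy, hx, hy, and_false, or_false]
    exact ⟨fun h => (Option.some_ne_none _ h.symm).elim, fun h => absurd (h ▸ hx) hy⟩
  · simp only [contractMap_of_mem hy, contractMap_of_notMem hx, hx, hy, and_true, or_false]
    exact ⟨fun h => (Option.some_ne_none _ h).elim, fun h => absurd (h ▸ hy) hx⟩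
  · rw [contractMap_of_notMem hx, contractMap_of_notMem hy]
    refine ⟨fun h => .inl (congrArg Subtype.val (Option.some.inj h)), ?_⟩
    rintro (rfl | h)
    · rfl
    · exact absurd h.1 hx

lemma contract_adj_of_adj {w : Set t.V} {x y : t.V} (h : t.graph.Adj x y)
    (hne : t.contractMap w x ≠ t.contractMap w y) :
    (t.contract w).graph.Adj (t.contractMap w x) (t.contractMap w y) := by
  by_cases hx : x ∈ w <;> by_cases hy : y ∈ w
  · exact absurd (contractMap_eq_iff.2 (.inr ⟨hx, hy⟩)) hne
  · rw [contractMap_of_mem hx, contractMap_of_notMem hy]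
    exact ⟨x, hx, h⟩
  · rw [contractMap_of_mem hy, contractMap_of_notMem hx]
    exact ⟨y, hy, h.symm⟩
  · rw [contractMap_of_notMem hx, contractMap_of_notMem hy]
    exact h

lemma exists_adj_of_contract_adj {w : Set t.V} {a b : (t.contract w).V}
    (h : (t.contract w).graph.Adj a b) :
    ∃ x y, t.contractMap w x = a ∧ t.contractMap w y = b ∧ t.graph.Adj x y := by
  rcases a with _ | a <;> rcases b with _ | b
  · exact h.elim
  · obtain ⟨x, hx, hxb⟩ := h
    exact ⟨x, b, contractMap_of_mem hx, contractMap_of_notMem b.2, hxb⟩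
  · obtain ⟨x, hx, hxb⟩ := h
    exact ⟨a, x, contractMap_of_notMem a.2, contractMap_of_mem hx, hxb.symm⟩
  · exact ⟨a, b, contractMap_of_notMem a.2, contractMap_of_notMem b.2, h⟩

/-- Contracting a connected set of vertices of a tree gives a tree. -/
theorem IsTree.contract (ht : t.IsTree) {w : Set t.V} (hw : (t.graph.induce w).Connected) :
    (t.contract w).IsTree := by
  have ht' : t.graph.IsTree := ht
  obtain ⟨⟨a₀, ha₀⟩⟩ := hw.nonempty
  have hsurj : ∀ a : (t.contract w).V, ∃ x, t.contractMap w x = a := by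
    rintro (_ | a)
    · exact ⟨a₀, contractMap_of_mem ha₀⟩
    · exact ⟨a, contractMap_of_notMem a.2⟩
  refine ⟨?_, ?_⟩
  · have hreach : ∀ x y, t.graph.Reachable x y →
        (t.contract w).graph.Reachable (t.contractMap w x) (t.contractMap w y) := by
      rintro x y ⟨p⟩
      induction p with
      | nil => rfl
      | @cons u v _ h _ ih =>
        by_cases hne : t.contractMap w u = t.contractMap w v
        · rw [hne]; exact ih
        · exact (contract_adj_of_adj h hne).reachable.trans ih
    have : Nonempty (t.contract w).V := ⟨none⟩
    refine ⟨fun a b => ?_⟩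
    obtain ⟨x, rfl⟩ := hsurj a
    obtain ⟨y, rfl⟩ := hsurj b
    exact hreach x y (ht'.connected.preconnected x y)
  · rw [isAcyclic_iff_forall_adj_isBridge]
    intro a b hab
    obtain ⟨x, y, rfl, rfl, hxy⟩ := exists_adj_of_contract_adj hab
    have hbr := (isAcyclic_iff_forall_adj_isBridge.1 ht'.isAcyclic) hxy
    rw [isBridge_iff] at hbr ⊢
    intro hcon
    apply hbr
    have hfib : ∀ c d, t.contractMap w c = t.contractMap w d →
        (t.graph.deleteEdges {s(x, y)}).Reachable c d := by
      intro c d hcd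
      rcases contractMap_eq_iff.1 hcd with rfl | ⟨hc, hd⟩
      · rfl
      · obtain ⟨p⟩ := hw.preconnected ⟨c, hc⟩ ⟨d, hd⟩
        refine ⟨p.map (⟨Subtype.val, ?_⟩ : t.graph.induce w →g t.graph.deleteEdges {s(x, y)})⟩
        intro e f hef
        rw [deleteEdges_adj]
        refine ⟨hef, fun hs => hab.ne ?_⟩
        rw [Set.mem_singleton_iff, Sym2.eq_iff] at hs
        rw [contractMap_eq_iff]
        rcases hs with ⟨h1, h2⟩ | ⟨h1, h2⟩
        · exact .inr ⟨h1 ▸ e.2, h2 ▸ f.2⟩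
        · exact .inr ⟨h2 ▸ f.2, h1 ▸ e.2⟩
    have hlift : ∀ a b, ((t.contract w).graph.deleteEdges
        {s(t.contractMap w x, t.contractMap w y)}).Reachable a b →
        ∀ c d, t.contractMap w c = a → t.contractMap w d = b →
        (t.graph.deleteEdges {s(x, y)}).Reachable c d := by
      rintro a b ⟨p⟩
      induction p with
      | nil => exact fun c d hc hd => hfib c d (hc.trans hd.symm)
      | cons h _ ih =>
        intro c d hc hd
        rw [deleteEdges_adj] at h
        obtain ⟨e, f, rfl, rfl, hef⟩ := exists_adj_of_contract_adj h.1
        refine (hfib c e hc).trans (Reachable.trans ?_ (ih f d rfl hd))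
        refine Adj.reachable ?_
        rw [deleteEdges_adj]
        refine ⟨hef, fun hs => h.2 ?_⟩
        rw [Set.mem_singleton_iff] at hs ⊢
        exact congrArg (Sym2.map (t.contractMap w)) hs
    exact hlift _ _ hcon x y rfl rfl

lemma IsTree.contract_deg_some (ht : t.IsTree) {w : Set t.V} (hw : (t.graph.induce w).Connected)
    (x : {x // x ∉ w}) : (t.contract w).deg (some x) = t.deg x.1 := by
  have ht' : t.graph.IsTree := ht
  have himg : t.contractMap w '' (t.graph.neighborSet x.1) =
      (t.contract w).graph.neighborSet (some x) := by
    ext b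
    constructor
    · rintro ⟨y, hy, rfl⟩
      have hy' : t.graph.Adj x.1 y := hy
      have := contract_adj_of_adj (w := w) hy'
      rw [contractMap_of_notMem x.2] at this
      refine this fun h => ?_
      rw [← contractMap_of_notMem x.2, contractMap_eq_iff] at h
      exact h.elim hy'.ne fun h => x.2 h.1
    · rcases b with _ | b
      · rintro ⟨y, hy, hyx⟩
        exact ⟨y, hyx.symm, contractMap_of_mem hy⟩
      · intro h
        exact ⟨b.1, h, contractMap_of_notMem b.2⟩
  refine (congrArg Set.ncard himg).symm.trans (Set.InjOn.ncard_image ?_)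
  intro y hy z hz h
  rcases contractMap_eq_iff.1 h with h | ⟨h1, h2⟩
  · exact h
  · exact ht'.isAcyclic.eq_of_adj_of_preconnected hw.preconnected h1 h2 x.2
      (Adj.symm hy) (Adj.symm hz)

lemma contract_branchingNumber (t : RootedGraph.{u}) (w : Set t.V) :
    (t.contract w).branchingNumber = (t.graph.outerBoundary w).ncard := by
  have himg : (fun x : {x // x ∉ w} => x.1) '' {x | ∃ y ∈ w, t.graph.Adj y x.1} =
      t.graph.outerBoundary w := by
    ext c
    constructor
    · rintro ⟨x, hx, rfl⟩
      exact ⟨x.2, hx⟩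
    · rintro ⟨h1, h2⟩
      exact ⟨⟨c, h1⟩, h2, rfl⟩
  have himg' : some '' {x : {x // x ∉ w} | ∃ y ∈ w, t.graph.Adj y x.1} =
      (t.contract w).graph.neighborSet none := by
    ext b
    constructor
    · rintro ⟨x, hx, rfl⟩
      exact hx
    · rcases b with _ | b
      · exact fun h => h.elim
      · exact fun h => ⟨b, h, rfl⟩
  rw [← himg, Set.ncard_image_of_injective _ Subtype.val_injective]
  exact (congrArg Set.ncard himg').symm.trans
    (Set.ncard_image_of_injective _ (Option.some_injective _))

/-- The branches of the contraction are paths if and only if `w` contains all branching vertices. -/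
theorem IsTree.branchesOnlyAtRoot_contract_iff (ht : t.IsTree) {w : Set t.V}
    (hw : (t.graph.induce w).Connected) :
    (t.contract w).BranchesOnlyAtRoot ↔ ∀ x, 3 ≤ t.deg x → x ∈ w := by
  rw [BranchesOnlyAtRoot, (ht.contract hw).isTall_branch_iff, and_iff_right (ht.contract hw)]
  constructor
  · intro h x hx
    by_contra hxw
    have := h (some ⟨x, hxw⟩) (Option.some_ne_none _)
    rw [ht.contract_deg_some hw] at this
    change t.deg x ≤ 2 at this
    omega
  · rintro h (_ | x) hx
    · exact absurd rfl hx
    · rw [ht.contract_deg_some hw]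
      by_contra hcon
      exact x.2 (h x.1 (by omega))

end RootedGraph

namespace RootedGraph

open SimpleGraph

variable {t : RootedGraph.{u}}

namespace ProperSubtree

lemma connected_induce (w : t.ProperSubtree) : (t.graph.induce w.verts).Connected := by
  obtain ⟨k, φ, -⟩ := w.path
  exact φ.connected_iff.1 (pathGraph_connected (2 * k))

/-- The isomorphisms between the merging product and the tree that are counted by `omega`. -/
abbrev MergeIso (w : t.ProperSubtree) (f : w.quot.Children → w.toRooted.V) : Type u :=
  {φ : (w.toRooted.merge w.quot f).graph ≃g w.reroot.graph //
      φ (w.toRooted.merge w.quot f).root = w.reroot.root ∧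
      φ '' Set.range (Sum.inl : w.toRooted.V → (w.toRooted.merge w.quot f).V) = w.verts}

/-- The automorphisms that map `w` to itself and fix its root. -/
abbrev Stab (w : t.ProperSubtree) : Type u :=
  {ψ : t.graph ≃g t.graph // ψ w.root = w.root ∧ ψ '' w.verts = w.verts}

/-- The vertex of `τ` that corresponds to a vertex of `τ_w` other than the root. -/
def outVert (w : t.ProperSubtree) (y : w.quot.V) (hy : y ≠ w.quot.root) : {x : t.V // x ∉ w.verts} :=
  Option.get y (Option.ne_none_iff_isSome.1 hy)

lemma some_outVert (w : t.ProperSubtree) (y : w.quot.V) (hy : y ≠ w.quot.root) :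
    (some (w.outVert y hy) : Option {x : t.V // x ∉ w.verts}) = y :=
  Option.some_get _

lemma outVert_adj (w : t.ProperSubtree) {y z : w.quot.V} (hy : y ≠ w.quot.root)
    (hz : z ≠ w.quot.root) :
    t.graph.Adj (w.outVert y hy).1 (w.outVert z hz).1 ↔ w.quot.graph.Adj y z := by
  rcases y with _ | y
  · exact absurd rfl hy
  · rcases z with _ | z
    · exact absurd rfl hz
    · exact Iff.rfl

lemma exists_adj_outVert (w : t.ProperSubtree) {y : w.quot.V} (hy : y ≠ w.quot.root) :
    (∃ x ∈ w.verts, t.graph.Adj x (w.outVert y hy).1) ↔ w.quot.graph.Adj w.quot.root y := by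
  rcases y with _ | y
  · exact absurd rfl hy
  · exact Iff.rfl

variable {w : t.ProperSubtree} {f : w.quot.Children → w.toRooted.V}

lemma MergeIso.inl_mem (φ : w.MergeIso f) (a : w.toRooted.V) : φ.1 (.inl a) ∈ w.verts :=
  φ.2.2.subset ⟨_, ⟨a, rfl⟩, rfl⟩

lemma MergeIso.inr_notMem (φ : w.MergeIso f) (y : {y : w.quot.V // y ≠ w.quot.root}) :
    φ.1 (.inr y) ∉ w.verts := by
  intro h
  obtain ⟨_, ⟨a, rfl⟩, ha⟩ := φ.2.2.superset h
  exact Sum.inl_ne_inr (φ.1.injective ha)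

/-- The automorphism of `w` induced by an isomorphism from the merging product. -/
noncomputable def MergeIso.inner (φ : w.MergeIso f) : RootIso w.toRooted w.toRooted :=
  ⟨⟨Equiv.ofBijective (fun a : w.verts => (⟨φ.1 (.inl a), φ.inl_mem a⟩ : w.verts)) <|
      Finite.injective_iff_bijective.1 fun a b h =>
        Sum.inl_injective (φ.1.injective (congrArg Subtype.val h)), by
      intro a b
      exact φ.1.map_adj_iff (v := .inl a) (w := .inl b)⟩, Subtype.ext φ.2.1⟩

/-- The map of `τ_w` induced by an isomorphism from the merging product. -/
def MergeIso.outerFun (φ : w.MergeIso f) : w.quot.V → w.quot.V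
  | none => none
  | some x => some ⟨φ.1 (.inr ⟨some x, Option.some_ne_none x⟩), φ.inr_notMem _⟩

lemma MergeIso.outerFun_injective (φ : w.MergeIso f) : Function.Injective φ.outerFun := by
  rintro (_ | x) (_ | y) h
  · rfl
  · exact absurd h.symm (Option.some_ne_none _)
  · exact absurd h (Option.some_ne_none _)
  · have h1 := Sum.inr_injective (φ.1.injective (congrArg Subtype.val (Option.some.inj h)))
    exact congrArg Subtype.val h1

lemma MergeIso.adj_inr_iff (φ : w.MergeIso f) (x : {x : t.V // x ∉ w.verts}) :
    (∃ a ∈ w.verts, t.graph.Adj a (φ.1 (.inr ⟨some x, Option.some_ne_none x⟩))) ↔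
      w.quot.graph.Adj w.quot.root (some x) := by
  constructor
  · rintro ⟨a, ha, h⟩
    obtain ⟨_, ⟨b, rfl⟩, rfl⟩ := φ.2.2.superset ha
    obtain ⟨h, -⟩ := φ.1.map_adj_iff.1 h
    exact h
  · intro h
    exact ⟨_, φ.inl_mem (f ⟨some x, h⟩), φ.1.map_adj_iff.2 ⟨h, rfl⟩⟩

/-- The automorphism of `τ_w` induced by an isomorphism from the merging product. -/
noncomputable def MergeIso.outer (φ : w.MergeIso f) : RootIso w.quot w.quot :=
  ⟨⟨Equiv.ofBijective φ.outerFun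
      (Finite.injective_iff_bijective.1 φ.outerFun_injective), by
      rintro (_ | x) (_ | y)
      · exact Iff.rfl
      · exact φ.adj_inr_iff y
      · exact φ.adj_inr_iff x
      · exact φ.1.map_adj_iff (v := .inr ⟨some x, Option.some_ne_none x⟩)
          (w := .inr ⟨some y, Option.some_ne_none y⟩)⟩, rfl⟩

lemma mergeIso_ext {f f' : w.quot.Children → w.toRooted.V} (φ : w.MergeIso f) (φ' : w.MergeIso f')
    (hi : φ.inner = φ'.inner) (ho : φ.outer = φ'.outer) :
    (⟨f, φ⟩ : Σ f, w.MergeIso f) = ⟨f', φ'⟩ := by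
  have hl : ∀ a : w.toRooted.V, φ.1 (.inl a) = φ'.1 (.inl a) := fun a =>
    congrArg (fun θ : RootIso w.toRooted w.toRooted => (θ.1 a).1) hi
  have hr : ∀ y, φ.1 (.inr y) = φ'.1 (.inr y) := by
    rintro ⟨_ | y, hy⟩
    · exact absurd rfl hy
    · have := congrArg (fun θ : RootIso w.quot w.quot => θ.1 (some y)) ho
      exact congrArg Subtype.val (Option.some.inj this)
  have hff : f = f' := by
    funext c
    have h1 : (w.toRooted.merge w.quot f').graph.Adj (.inl (f' c)) (.inr ⟨c.1, c.2.ne'⟩) :=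
      ⟨c.2, rfl⟩
    have h2 := φ'.1.map_adj_iff.2 h1
    rw [← hl, ← hr] at h2
    obtain ⟨_, h⟩ := φ.1.map_adj_iff.1 h2
    exact h
  subst hff
  congr 1
  refine Subtype.ext (DFunLike.ext _ _ ?_)
  rintro (a | y)
  · exact hl a
  · exact hr y

lemma exists_mergeIso (ht : t.IsTree) (α : RootIso w.toRooted w.toRooted)
    (β : RootIso w.quot w.quot) : ∃ f, ∃ φ : w.MergeIso f, φ.inner = α ∧ φ.outer = β := by
  have ht' : t.graph.IsTree := ht
  have hβ : ∀ y, β.1 y ≠ w.quot.root ↔ y ≠ w.quot.root := by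
    intro y
    rw [not_iff_not]
    exact ⟨fun h => β.1.injective (h.trans β.2.symm), fun h => h ▸ β.2⟩
  have hβadj : ∀ y, w.quot.graph.Adj w.quot.root (β.1 y) ↔ w.quot.graph.Adj w.quot.root y := by
    intro y
    have := β.1.map_adj_iff (v := w.quot.root) (w := y)
    rwa [β.2] at this
  have hatt : ∀ c : w.quot.Children, ∃ a : w.toRooted.V,
      t.graph.Adj (α.1 a).1 (w.outVert (β.1 c.1) ((hβ _).2 c.2.ne')).1 := by
    intro c
    obtain ⟨x, hx, h⟩ := (w.exists_adj_outVert ((hβ _).2 c.2.ne')).2 ((hβadj _).2 c.2)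
    refine ⟨α.1.symm ⟨x, hx⟩, ?_⟩
    have e : (α.1 (α.1.symm ⟨x, hx⟩)).1 = x :=
      congrArg Subtype.val (α.1.apply_symm_apply ⟨x, hx⟩)
    rwa [e]
  choose f hf using hatt
  let F : w.toRooted.V ⊕ {y : w.quot.V // y ≠ w.quot.root} → t.V :=
    Sum.elim (fun a => (α.1 a).1) fun y => (w.outVert (β.1 y.1) ((hβ _).2 y.2)).1
  have hF : Function.Bijective F := by
    constructor
    · rintro (a | y) (b | z) h
      · exact congrArg _ (α.1.injective (Subtype.ext h))
      · have h' : (α.1 a).1 = (w.outVert (β.1 z.1) ((hβ _).2 z.2)).1 := h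
        exact absurd (h' ▸ (α.1 a).2) (w.outVert (β.1 z.1) ((hβ _).2 z.2)).2
      · have h' : (w.outVert (β.1 y.1) ((hβ _).2 y.2)).1 = (α.1 b).1 := h
        exact absurd (h'.symm ▸ (α.1 b).2) (w.outVert (β.1 y.1) ((hβ _).2 y.2)).2
      · have h1 := congrArg some (Subtype.ext h :
          w.outVert (β.1 y.1) ((hβ _).2 y.2) = w.outVert (β.1 z.1) ((hβ _).2 z.2))
        rw [some_outVert, some_outVert] at h1
        exact congrArg _ (Subtype.ext (β.1.injective h1))
    · intro z
      by_cases hz : z ∈ w.verts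
      · refine ⟨.inl (α.1.symm ⟨z, hz⟩), ?_⟩
        exact congrArg Subtype.val (α.1.apply_symm_apply ⟨z, hz⟩)
      · have hs : β.1 (β.1.symm (some ⟨z, hz⟩)) = some ⟨z, hz⟩ := β.1.apply_symm_apply _
        have hne : β.1.symm (some ⟨z, hz⟩) ≠ w.quot.root := by
          rw [← hβ, hs]
          exact Option.some_ne_none _
        refine ⟨.inr ⟨_, hne⟩, ?_⟩
        have h1 := (w.some_outVert _ ((hβ _).2 hne)).trans hs
        exact congrArg Subtype.val (Option.some.inj h1)
  have hcross : ∀ (a : w.toRooted.V) (y : {y : w.quot.V // y ≠ w.quot.root}),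
      t.graph.Adj (F (.inl a)) (F (.inr y)) ↔
        ∃ h : w.quot.graph.Adj w.quot.root y.1, f ⟨y.1, h⟩ = a := by
    intro a y
    constructor
    · intro h
      have hy : w.quot.graph.Adj w.quot.root y.1 := by
        rw [← hβadj, ← w.exists_adj_outVert ((hβ _).2 y.2)]
        exact ⟨_, (α.1 a).2, h⟩
      refine ⟨hy, ?_⟩
      have := ht'.isAcyclic.eq_of_adj_of_preconnected w.connected_induce.preconnected
        (α.1 (f ⟨y.1, hy⟩)).2 (α.1 a).2 (w.outVert (β.1 y.1) ((hβ _).2 y.2)).2 (hf ⟨y.1, hy⟩) h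
      exact α.1.injective (Subtype.ext this)
    · rintro ⟨hy, rfl⟩
      exact hf ⟨y.1, hy⟩
  let φ : (w.toRooted.merge w.quot f).graph ≃g w.reroot.graph := ⟨Equiv.ofBijective F hF, by
    rintro (a | y) (b | z)
    · exact α.1.map_adj_iff
    · exact hcross a z
    · exact (t.graph.adj_comm _ _).trans (hcross b y)
    · exact (w.outVert_adj ((hβ _).2 y.2) ((hβ _).2 z.2)).trans β.1.map_adj_iff⟩
  have himg : φ '' Set.range (Sum.inl : w.toRooted.V → (w.toRooted.merge w.quot f).V) =
      w.verts := by
    ext z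
    constructor
    · rintro ⟨_, ⟨a, rfl⟩, rfl⟩
      exact (α.1 a).2
    · intro hz
      exact ⟨_, ⟨α.1.symm ⟨z, hz⟩, rfl⟩, congrArg Subtype.val (α.1.apply_symm_apply ⟨z, hz⟩)⟩
  refine ⟨f, ⟨φ, congrArg Subtype.val α.2, himg⟩, ?_, ?_⟩
  · exact Subtype.ext (DFunLike.ext _ _ fun a => rfl)
  · refine Subtype.ext (DFunLike.ext _ _ ?_)
    rintro (_ | y)
    · exact β.2.symm
    · exact w.some_outVert (β.1 (some y)) ((hβ _).2 (Option.some_ne_none y))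

lemma card_mergeIso (f : w.quot.Children → w.toRooted.V) [Decidable (Nonempty (w.MergeIso f))] :
    Nat.card (w.MergeIso f) = if Nonempty (w.MergeIso f) then Nat.card w.Stab else 0 := by
  split_ifs with h
  · obtain ⟨φ⟩ := h
    refine Nat.card_congr
      { toFun := fun ψ => ⟨ψ.1.comp φ.1.symm, ?_, ?_⟩
        invFun := fun ψ => ⟨ψ.1.comp φ.1, ?_, ?_⟩
        left_inv := ?_
        right_inv := ?_ }
    · have : φ.1.symm w.root = (w.toRooted.merge w.quot f).root :=
        (RelIso.symm_apply_eq φ.1).2 φ.2.1.symm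
      change ψ.1 (φ.1.symm w.root) = w.root
      rw [this]
      exact ψ.2.1
    · have : φ.1.symm '' w.verts =
          Set.range (Sum.inl : w.toRooted.V → (w.toRooted.merge w.quot f).V) := by
        exact (congrArg (φ.1.symm '' ·) φ.2.2).symm.trans (φ.1.toEquiv.symm_image_image _)
      exact (Set.image_comp ψ.1 φ.1.symm w.verts).trans
        ((congrArg (ψ.1 '' ·) this).trans ψ.2.2)
    · change ψ.1 (φ.1 (w.toRooted.merge w.quot f).root) = w.root
      rw [φ.2.1]
      exact ψ.2.1
    · exact (Set.image_comp ψ.1 φ.1 _).trans ((congrArg (ψ.1 '' ·) φ.2.2).trans ψ.2.2)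
    · intro ψ
      refine Subtype.ext (DFunLike.ext _ _ fun x => ?_)
      exact congrArg ψ.1 (φ.1.symm_apply_apply x)
    · intro ψ
      refine Subtype.ext (DFunLike.ext _ _ fun x => ?_)
      exact congrArg ψ.1 (φ.1.apply_symm_apply x)
  · rw [not_nonempty_iff] at h
    exact Nat.card_of_isEmpty

/-- Double counting of the pairs of a tuple `f` and an isomorphism `w ×_f τ_w → τ^w`. -/
theorem omega_mul_card_stab (ht : t.IsTree) (w : t.ProperSubtree) :
    w.omega * Nat.card w.Stab = Nat.card (RootIso w.toRooted w.toRooted) * w.quot.sigma := by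
  classical
  have := Fintype.ofFinite w.quot.Children
  have := Fintype.ofFinite w.toRooted.V
  have h1 : Nat.card (Σ f, w.MergeIso f) =
      Nat.card (RootIso w.toRooted w.toRooted) * Nat.card (RootIso w.quot w.quot) := by
    rw [← Nat.card_prod]
    refine Nat.card_congr (Equiv.ofBijective (fun x => (x.2.inner, x.2.outer)) ⟨?_, ?_⟩)
    · rintro ⟨f, φ⟩ ⟨f', φ'⟩ h
      exact mergeIso_ext φ φ' (congrArg Prod.fst h) (congrArg Prod.snd h)
    · rintro ⟨α, β⟩
      obtain ⟨f, φ, h1, h2⟩ := w.exists_mergeIso ht α β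
      exact ⟨⟨f, φ⟩, Prod.ext h1 h2⟩
  rw [(ht.contract w.connected_induce).sigma_eq, ← h1, Nat.card_sigma,
    Finset.sum_congr rfl fun f _ => w.card_mergeIso f, Finset.sum_ite, Finset.sum_const_zero,
    add_zero, Finset.sum_const, smul_eq_mul]
  congr 1
  rw [← Fintype.card_subtype, ← Nat.card_eq_fintype_card]
  refine Nat.card_congr (Equiv.subtypeEquivRight fun f => ?_)
  exact ⟨fun ⟨φ, h⟩ => ⟨⟨φ, h⟩⟩, fun ⟨⟨φ, h⟩⟩ => ⟨φ, h⟩⟩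

end ProperSubtree

end RootedGraph

namespace SimpleGraph

lemma pathGraph_aut_eq {n : ℕ} (ψ : pathGraph (n + 1) ≃g pathGraph (n + 1)) :
    (∀ i, ψ i = i) ∨ ∀ i, ψ i = Fin.rev i := by
  have hstep : ∀ (i : ℕ) (hi : i + 1 < n + 1),
      (ψ ⟨i, by omega⟩).1 + 1 = (ψ ⟨i + 1, hi⟩).1 ∨
        (ψ ⟨i + 1, hi⟩).1 + 1 = (ψ ⟨i, by omega⟩).1 := by
    intro i hi
    exact pathGraph_adj.1 (ψ.map_adj_iff.2 (pathGraph_adj.2 (.inl rfl)))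
  have hinj : ∀ (i : ℕ) (hi : i + 1 + 1 < n + 1),
      (ψ ⟨i, by omega⟩).1 ≠ (ψ ⟨i + 1 + 1, hi⟩).1 := by
    intro i hi h
    have := congrArg Fin.val (ψ.injective (Fin.ext h))
    dsimp only at this
    omega
  rcases Nat.eq_zero_or_pos n with rfl | hn
  · exact .inl fun i => Subsingleton.elim (α := Fin 1) _ _
  rcases hstep 0 (by omega) with h0 | h0
  · have hup : ∀ (i : ℕ) (hi : i + 1 < n + 1),
        (ψ ⟨i, by omega⟩).1 + 1 = (ψ ⟨i + 1, hi⟩).1 := by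
      intro i
      induction i with
      | zero => exact fun _ => h0
      | succ i ih =>
        intro hi
        have h1 := ih (by omega)
        have h2 := hinj i hi
        have h3 := hstep (i + 1) hi
        omega
    have hlin : ∀ (i : ℕ) (hi : i < n + 1), (ψ ⟨i, hi⟩).1 = (ψ ⟨0, by omega⟩).1 + i := by
      intro i
      induction i with
      | zero => exact fun _ => rfl
      | succ i ih =>
        intro hi
        have h1 := ih (by omega)
        have h2 := hup i hi
        omega
    have hl := hlin n (by omega)
    have hb := (ψ ⟨n, by omega⟩).2
    refine .inl fun i => Fin.ext ?_
    have := hlin i.1 i.2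
    simp only [Fin.eta] at this
    omega
  · have hdn : ∀ (i : ℕ) (hi : i + 1 < n + 1),
        (ψ ⟨i + 1, hi⟩).1 + 1 = (ψ ⟨i, by omega⟩).1 := by
      intro i
      induction i with
      | zero => exact fun _ => h0
      | succ i ih =>
        intro hi
        have h1 := ih (by omega)
        have h2 := hinj i hi
        have h3 := hstep (i + 1) hi
        omega
    have hlin : ∀ (i : ℕ) (hi : i < n + 1), (ψ ⟨i, hi⟩).1 + i = (ψ ⟨0, by omega⟩).1 := by
      intro i
      induction i with
      | zero => exact fun _ => rfl
      | succ i ih =>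
        intro hi
        have h1 := ih (by omega)
        have h2 := hdn i hi
        omega
    have hl := hlin n (by omega)
    have hb := (ψ ⟨0, by omega⟩).2
    refine .inr fun i => Fin.ext ?_
    have := hlin i.1 i.2
    simp only [Fin.eta] at this
    rw [Fin.val_rev]
    omega

/-- The reflection of a path. -/
def pathGraphRev (n : ℕ) : pathGraph n ≃g pathGraph n :=
  ⟨Fin.revPerm, by
    intro a b
    rw [pathGraph_adj, pathGraph_adj, Fin.revPerm_apply, Fin.revPerm_apply, Fin.val_rev,
      Fin.val_rev]
    omega⟩

lemma pathGraph_mem_support {n : ℕ} {a b : Fin n} (q : (pathGraph n).Walk a b) {i : Fin n}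
    (ha : a ≤ i) (hb : i ≤ b) : i ∈ q.support := by
  induction q with
  | nil => simp [le_antisymm hb ha]
  | @cons u v _ h q ih =>
    by_cases hi : i = u
    · simp [hi]
    · rw [Walk.support_cons]
      refine List.mem_cons_of_mem _ (ih ?_ hb)
      rw [pathGraph_adj] at h
      rw [Fin.le_def] at ha ⊢
      have : i.1 ≠ u.1 := fun e => hi (Fin.ext e)
      omega

lemma card_pathGraph_aut (k : ℕ) :
    Nat.card (pathGraph (2 * k + 1) ≃g pathGraph (2 * k + 1)) = if k = 0 then 1 else 2 := by
  split_ifs with hk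
  · subst hk
    have : Subsingleton (pathGraph (2 * 0 + 1) ≃g pathGraph (2 * 0 + 1)) :=
      ⟨fun a b => DFunLike.ext _ _ fun i => Subsingleton.elim (α := Fin 1) _ _⟩
    have : Nonempty (pathGraph (2 * 0 + 1) ≃g pathGraph (2 * 0 + 1)) := ⟨Iso.refl⟩
    exact Nat.card_eq_one_iff_unique.2 ⟨inferInstance, inferInstance⟩
  · rw [Nat.card_eq_two_iff]
    refine ⟨Iso.refl, pathGraphRev _, fun h => ?_, ?_⟩
    · have := congrArg Fin.val (DFunLike.congr_fun h (0 : Fin (2 * k + 1)))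
      change 0 = (Fin.rev (0 : Fin (2 * k + 1))).1 at this
      rw [Fin.val_rev] at this
      simp at this
      omega
    · refine Set.eq_univ_of_forall fun ψ => ?_
      rcases pathGraph_aut_eq ψ with h | h
      · exact .inl (DFunLike.ext _ _ h)
      · exact .inr (DFunLike.ext _ _ h)

lemma pathGraph_aut_middle {k : ℕ} (ψ : pathGraph (2 * k + 1) ≃g pathGraph (2 * k + 1)) :
    ψ ⟨k, by omega⟩ = ⟨k, by omega⟩ := by
  rcases pathGraph_aut_eq ψ with h | h
  · exact h _
  · rw [h]
    ext
    rw [Fin.val_rev]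
    dsimp only
    omega

variable {V : Type u} {G : SimpleGraph V}

lemma IsTree.length_eq_dist (hG : G.IsTree) {x y : V} {p : G.Walk x y} (hp : p.IsPath) :
    p.length = G.dist x y := by
  obtain ⟨q, hq, hl⟩ := hG.connected.exists_path_of_dist x y
  rw [← hl, Subtype.mk.inj <| (hG.isAcyclic.subsingleton_path x y).elim ⟨p, hp⟩ ⟨q, hq⟩]

/-- The path between two vertices of a tree as an induced subgraph. -/
lemma IsTree.exists_seg_iso (hG : G.IsTree) (x y : V) :
    ∃ ρ : pathGraph (G.dist x y + 1) ≃g G.induce (G.seg x y),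
      (ρ 0).1 = x ∧ (ρ (Fin.last _)).1 = y := by
  obtain ⟨p, hp, hl⟩ := hG.connected.exists_path_of_dist x y
  have hseg := hG.isAcyclic.seg_eq_support hp
  have hd : ∀ i ≤ p.length, G.dist x (p.getVert i) = i := by
    intro i hi
    rw [← hG.length_eq_dist (hp.take i), Walk.take_length]
    omega
  rw [← hl]
  let F : Fin (p.length + 1) → G.seg x y :=
    fun i => ⟨p.getVert i, by rw [hseg]; exact p.getVert_mem_support i⟩
  have hF : Function.Bijective F := by
    constructor
    · intro i j h
      have h' : p.getVert i = p.getVert j := congrArg Subtype.val h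
      have h1 := hd i (by omega)
      have h2 := hd j (by omega)
      rw [h'] at h1
      exact Fin.ext (h1.symm.trans h2)
    · rintro ⟨z, hz⟩
      rw [hseg] at hz
      obtain ⟨i, rfl, hi⟩ := Walk.mem_support_iff_exists_getVert.1 hz
      exact ⟨⟨i, by omega⟩, rfl⟩
  refine ⟨⟨Equiv.ofBijective F hF, ?_⟩, p.getVert_zero, ?_⟩
  · intro i j
    change G.Adj (p.getVert i) (p.getVert j) ↔ _
    rw [pathGraph_adj]
    constructor
    · intro h
      have h1 := hG.dist_eq_dist_add_one_of_adj x h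
      rw [hd i (by omega), hd j (by omega)] at h1
      omega
    · rintro (h | h)
      · rw [← h]; exact p.adj_getVert_succ (by omega)
      · rw [← h]; exact (p.adj_getVert_succ (by omega)).symm
  · exact p.getVert_length

lemma IsTree.seg_of_iso (hG : G.IsTree) {n : ℕ} {S : Set V}
    (ρ : pathGraph (n + 1) ≃g G.induce S) : G.seg (ρ 0).1 (ρ (Fin.last n)).1 = S := by
  obtain ⟨q, hq⟩ := ((pathGraph_connected n).preconnected 0 (Fin.last n)).exists_isPath
  let f : pathGraph (n + 1) →g G := (Embedding.induce S).toHom.comp ρ.toHom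
  have hf : Function.Injective f := Subtype.val_injective.comp ρ.injective
  have h := hG.isAcyclic.seg_eq_support (Walk.IsPath.map hf hq)
  refine h.trans ?_
  ext z
  rw [Set.mem_ofPred_eq, Walk.support_map, List.mem_map]
  constructor
  · rintro ⟨i, -, rfl⟩
    exact (ρ i).2
  · intro hz
    refine ⟨ρ.symm ⟨z, hz⟩, pathGraph_mem_support q (Fin.zero_le _) (Fin.le_last _), ?_⟩
    exact congrArg Subtype.val (ρ.apply_symm_apply ⟨z, hz⟩)

lemma ncard_of_pathGraph_iso {n : ℕ} {S : Set V} (ρ : pathGraph n ≃g G.induce S) :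
    S.ncard = n := by
  rw [← Nat.card_coe_set_eq, ← Nat.card_congr ρ.toEquiv, Nat.card_fin]

lemma IsTree.seg_eq_iff_of_iso (hG : G.IsTree) {n : ℕ} {S : Set V}
    (ρ : pathGraph (n + 1) ≃g G.induce S) {x y : V} :
    G.seg x y = S ↔ x = (ρ 0).1 ∧ y = (ρ (Fin.last n)).1 ∨
      x = (ρ (Fin.last n)).1 ∧ y = (ρ 0).1 := by
  constructor
  · rintro rfl
    obtain ⟨ρ', h0, h1⟩ := hG.exists_seg_iso x y
    have hn := (ncard_of_pathGraph_iso ρ').symm.trans (ncard_of_pathGraph_iso ρ)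
    obtain rfl : G.dist x y = n := by omega
    have hx : (ρ (ρ.symm (ρ' 0))).1 = x := by rw [RelIso.apply_symm_apply, h0]
    have hy : (ρ (ρ.symm (ρ' (Fin.last _)))).1 = y := by rw [RelIso.apply_symm_apply, h1]
    rcases pathGraph_aut_eq (ρ.symm.comp ρ') with h | h
    · left
      have e0 : ρ.symm (ρ' 0) = 0 := h 0
      have e1 : ρ.symm (ρ' (Fin.last _)) = Fin.last _ := h _
      rw [e0] at hx
      rw [e1] at hy
      exact ⟨hx.symm, hy.symm⟩
    · right
      have e0 : ρ.symm (ρ' 0) = Fin.last _ := (h 0).trans (Fin.rev_zero _)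
      have e1 : ρ.symm (ρ' (Fin.last _)) = 0 := (h _).trans (Fin.rev_last _)
      rw [e0] at hx
      rw [e1] at hy
      exact ⟨hx.symm, hy.symm⟩
  · rintro (⟨rfl, rfl⟩ | ⟨rfl, rfl⟩)
    · exact hG.seg_of_iso ρ
    · rw [seg_comm]
      exact hG.seg_of_iso ρ

lemma alternating_of_pathGraph_iso {s : V → ℚ} (hs : ∀ a b, G.Adj a b → s a = -s b) {n : ℕ}
    {S : Set V} (ρ : pathGraph (n + 1) ≃g G.induce S) (i : ℕ) (hi : i < n + 1) :
    s (ρ ⟨i, hi⟩).1 = (-1) ^ i * s (ρ 0).1 := by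
  induction i with
  | zero => simp
  | succ i ih =>
    have hadj : G.Adj (ρ ⟨i + 1, hi⟩).1 (ρ ⟨i, by omega⟩).1 :=
      ρ.map_adj_iff.2 (pathGraph_adj.2 (.inr rfl))
    rw [hs _ _ hadj, ih (by omega), pow_succ]
    ring

lemma outerBoundary_image (φ : G ≃g G) (S : Set V) :
    G.outerBoundary (φ '' S) = φ '' G.outerBoundary S := by
  ext c
  constructor
  · rintro ⟨h1, _, ⟨x, hx, rfl⟩, h⟩
    refine ⟨φ.symm c, ⟨fun hc => h1 ⟨_, hc, φ.apply_symm_apply c⟩, x, hx, ?_⟩,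
      φ.apply_symm_apply c⟩
    rw [← φ.map_adj_iff, φ.apply_symm_apply]
    exact h
  · rintro ⟨c, ⟨h1, x, hx, h⟩, rfl⟩
    refine ⟨?_, φ x, ⟨x, hx, rfl⟩, φ.map_adj_iff.2 h⟩
    rintro ⟨d, hd, e⟩
    exact h1 (φ.injective e ▸ hd)

end SimpleGraph

namespace RootedGraph

open SimpleGraph

variable {t : RootedGraph.{u}}

lemma deg_apply (φ : t.graph ≃g t.graph) (x : t.V) : t.deg (φ x) = t.deg x := by
  have := outerBoundary_image φ {x}
  rw [Set.image_singleton, outerBoundary_singleton, outerBoundary_singleton] at this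
  rw [deg, this, Set.ncard_image_of_injective _ φ.injective, deg]

namespace ProperSubtree

/-- A subtree in `W(τ)` is determined by its vertices. -/
lemma ext_verts {w w' : t.ProperSubtree} (h : w.verts = w'.verts) : w = w' := by
  refine ProperSubtree.ext h ?_
  obtain ⟨S, r, hr, h1, h2, k, ρ, hρ⟩ := w
  obtain ⟨S', r', hr', h1', h2', k', ρ', hρ'⟩ := w'
  obtain rfl : S = S' := h
  have hk := (ncard_of_pathGraph_iso ρ).symm.trans (ncard_of_pathGraph_iso ρ')
  obtain rfl : k = k' := by omega
  have hm := pathGraph_aut_middle (ρ.symm.comp ρ')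
  have hm' : ρ' ⟨k, by omega⟩ = ρ ⟨k, by omega⟩ := (RelIso.symm_apply_eq ρ).1 hm
  exact congrArg Subtype.val (hρ.symm.trans (hm'.symm.trans hρ'))

lemma card_rootIso (w : t.ProperSubtree) :
    Nat.card (RootIso w.toRooted w.toRooted) = if w.verts.ncard = 1 then 1 else 2 := by
  obtain ⟨k, ρ, hρ⟩ := w.path
  have hn : w.verts.ncard = 2 * k + 1 := ncard_of_pathGraph_iso ρ
  have hk : w.verts.ncard = 1 ↔ k = 0 := by omega
  simp only [hk]
  rw [← card_pathGraph_aut k]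
  refine Nat.card_congr
    { toFun := fun α => ρ.symm.comp (α.1.comp ρ)
      invFun := fun ψ => ⟨ρ.comp (ψ.comp ρ.symm), ?_⟩
      left_inv := ?_
      right_inv := ?_ }
  · have h1 : ρ.symm ⟨w.root, w.root_mem⟩ = ⟨k, by omega⟩ := (RelIso.symm_apply_eq ρ).2 hρ.symm
    change ρ (ψ (ρ.symm ⟨w.root, w.root_mem⟩)) = ⟨w.root, w.root_mem⟩
    rw [h1, pathGraph_aut_middle]
    exact hρ
  · intro α
    refine Subtype.ext (DFunLike.ext _ _ fun x => ?_)
    change ρ (ρ.symm (α.1 (ρ (ρ.symm x)))) = α.1 x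
    exact (ρ.apply_symm_apply _).trans (congrArg α.1 (ρ.apply_symm_apply x))
  · intro ψ
    refine DFunLike.ext _ _ fun x => ?_
    change ρ.symm (ρ (ψ (ρ.symm (ρ x)))) = ψ x
    exact (ρ.symm_apply_apply _).trans (congrArg ψ (ρ.symm_apply_apply x))

/-- The image of a subtree under an automorphism. -/
def map (ht : t.IsTree) (φ : t.graph ≃g t.graph) (w : t.ProperSubtree) : t.ProperSubtree :=
  have hpath : ∃ (k : ℕ) (ρ : (theta k).graph ≃g t.graph.induce (φ '' w.verts)),
      ρ (theta k).root = ⟨φ w.root, ⟨_, w.root_mem, rfl⟩⟩ := by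
    obtain ⟨k, ρ, hρ⟩ := w.path
    let e : t.graph.induce w.verts ≃g t.graph.induce (φ '' w.verts) :=
      ⟨φ.toEquiv.image w.verts, φ.map_adj_iff⟩
    exact ⟨k, e.comp ρ, (congrArg e hρ).trans rfl⟩
  { verts := φ '' w.verts
    root := φ w.root
    root_mem := ⟨_, w.root_mem, rfl⟩
    strict := fun h => w.strict <| by
      rw [← φ.toEquiv.symm_image_image w.verts]
      exact (congrArg (φ.toEquiv.symm '' ·) h).trans
        (Set.image_univ_of_surjective φ.toEquiv.symm.surjective)
    contract_mem := by
      obtain ⟨k, ρ, -⟩ := hpath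
      rw [ht.branchesOnlyAtRoot_contract_iff (ρ.connected_iff.1 (pathGraph_connected (2 * k)))]
      intro x hx
      refine ⟨φ.symm x, ?_, φ.apply_symm_apply x⟩
      refine (ht.branchesOnlyAtRoot_contract_iff w.connected_induce).1 w.contract_mem _ ?_
      rwa [deg_apply]
    path := hpath }

/-- The subtree in `W(τ)` with given end vertices. -/
lemma exists_verts_eq_seg (ht : t.IsTree) {s : t.V → ℚ} (hs : ∀ a b, t.graph.Adj a b → s a = -s b)
    (hs0 : ∀ a, s a ≠ 0) {x y : t.V} (hxy : s x = s y) (hB : ∀ z, 3 ≤ t.deg z → z ∈ t.graph.seg x y)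
    (hne : t.graph.seg x y ≠ Set.univ) : ∃ w : t.ProperSubtree, w.verts = t.graph.seg x y := by
  have ht' : t.graph.IsTree := ht
  obtain ⟨ρ, h0, h1⟩ := ht'.exists_seg_iso x y
  have hsgn := alternating_of_pathGraph_iso hs ρ (t.graph.dist x y) (Nat.lt_succ_self _)
  rw [h0] at hsgn
  have heven : Even (t.graph.dist x y) := by
    by_contra hodd
    rw [Nat.not_even_iff_odd] at hodd
    rw [hodd.neg_one_pow] at hsgn
    have h1' : s (ρ ⟨t.graph.dist x y, Nat.lt_succ_self _⟩).1 = s y := congrArg s h1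
    rw [h1', ← hxy] at hsgn
    exact hs0 x (by linarith)
  obtain ⟨k, hk⟩ := heven
  have hk' : t.graph.dist x y = 2 * k := by omega
  rw [hk'] at ρ
  exact ⟨{
    verts := t.graph.seg x y
    root := (ρ ⟨k, by omega⟩).1
    root_mem := (ρ ⟨k, by omega⟩).2
    strict := hne
    contract_mem := (ht.branchesOnlyAtRoot_contract_iff (ht'.connected_induce_seg x y)).2 hB
    path := ⟨k, ρ, rfl⟩ }, rfl⟩

end ProperSubtree

end RootedGraph

namespace SimpleGraph

variable {V : Type u} {G : SimpleGraph V}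

/-- The vertices of a tree that is a path have degree at most two. -/
lemma IsTree.ncard_neighborSet_le_two (hG : G.IsTree) {x y : V} (h : G.seg x y = Set.univ)
    (z : V) : (G.neighborSet z).ncard ≤ 2 := by
  obtain ⟨ρ, -⟩ := hG.exists_seg_iso x y
  have hmem : ∀ a, a ∈ G.seg x y := fun a => h ▸ Set.mem_univ a
  let j : V → ℕ := fun a => (ρ.symm ⟨a, hmem a⟩).1
  have hj : Function.Injective j := by
    intro a b hab
    exact congrArg Subtype.val (ρ.symm.injective (Fin.ext hab))
  have hsub : j '' G.neighborSet z ⊆ {j z + 1, j z - 1} := by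
    rintro _ ⟨a, ha, rfl⟩
    have : (G.induce (G.seg x y)).Adj ⟨z, hmem z⟩ ⟨a, hmem a⟩ := ha
    have h2 := pathGraph_adj.1 (ρ.symm.map_adj_iff.2 this)
    change j z + 1 = j a ∨ j a + 1 = j z at h2
    simp only [Set.mem_insert_iff, Set.mem_singleton_iff]
    omega
  rw [← Set.ncard_image_of_injective _ hj]
  exact (Set.ncard_le_ncard hsub).trans
    ((Set.ncard_insert_le _ _).trans (by rw [Set.ncard_singleton]))

/-- In a tree without branching vertices, the boundary of a path is determined by the degrees of its
end vertices. -/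
lemma IsTree.ncard_outerBoundary_seg_of_le_two [Finite V] (hG : G.IsTree)
    (hdeg : ∀ z, (G.neighborSet z).ncard ≤ 2) {x y : V} (hxy : x ≠ y) :
    (G.outerBoundary (G.seg y x)).ncard + 2 =
      (G.neighborSet y).ncard + (G.neighborSet x).ncard := by
  induction h : G.dist y x using Nat.strong_induction_on generalizing x with
  | _ n ih =>
    obtain ⟨p, hp, hd, -, hseg, hx⟩ := hG.exists_parent hxy
    have hb := hG.ncard_outerBoundary_seg hp hseg hx
    by_cases hpy : p = y
    · subst hpy
      rw [seg_self, outerBoundary_singleton] at hb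
      exact hb
    · have h1 := ih (G.dist y p) (by omega) hpy rfl
      obtain ⟨q, hq, hqd, -⟩ := hG.exists_parent hpy
      have hqx : q ≠ x := by rintro rfl; omega
      have h2 : 2 ≤ (G.neighborSet p).ncard := by
        rw [← Set.ncard_pair hqx]
        refine Set.ncard_le_ncard ?_
        rintro _ (rfl | rfl)
        exacts [hq.symm, hp]
      have := hdeg p
      omega

open Classical in
/-- The weight `2 ^ b` of the path from `x` to `y`, provided it contains all branching vertices. -/
noncomputable def segWeight (G : SimpleGraph V) (x y : V) : ℚ :=
  if ∀ z, 3 ≤ (G.neighborSet z).ncard → z ∈ G.seg x y then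
    2 ^ (G.outerBoundary (G.seg x y)).ncard else 0

lemma segWeight_comm (x y : V) : G.segWeight x y = G.segWeight y x := by
  rw [segWeight, segWeight, seg_comm]

lemma segWeight_balance [Finite V] (hG : G.IsTree) (hdeg : ∀ z, (G.neighborSet z).ncard ≤ 3)
    {x y p : V} (hp : G.Adj p x) (hseg : G.seg y x = insert x (G.seg y p))
    (hx : x ∉ G.seg y p) :
    G.segWeight y x = G.segWeight y p / 2 +
      G.segWeight y x * ((G.neighborSet x).ncard - 1) / 2 := by
  have hb := hG.ncard_outerBoundary_seg hp hseg hx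
  have hpos : 0 < (G.neighborSet x).ncard := (Set.ncard_pos).2 ⟨p, hp.symm⟩
  by_cases h : ∀ z, 3 ≤ (G.neighborSet z).ncard → z ∈ G.seg y p
  · have h' : ∀ z, 3 ≤ (G.neighborSet z).ncard → z ∈ G.seg y x := by
      intro z hz
      rw [hseg]
      exact .inr (h z hz)
    have hx2 : (G.neighborSet x).ncard < 3 := not_le.1 fun h3 => hx (h x h3)
    rw [segWeight, segWeight, if_pos h, if_pos h']
    obtain h1 | h2 : (G.neighborSet x).ncard = 1 ∨ (G.neighborSet x).ncard = 2 := by omega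
    · have : (G.outerBoundary (G.seg y p)).ncard = (G.outerBoundary (G.seg y x)).ncard + 1 := by
        omega
      rw [this, h1, pow_succ]
      push_cast; ring
    · have : (G.outerBoundary (G.seg y p)).ncard = (G.outerBoundary (G.seg y x)).ncard := by
        omega
      rw [this, h2]
      push_cast; ring
  · rw [segWeight, segWeight, if_neg h]
    split_ifs with h'
    · have hx3 : (G.neighborSet x).ncard = 3 := by
        push Not at h
        obtain ⟨z, hz, hzp⟩ := h
        have := h' z hz
        rw [hseg] at this
        obtain rfl := this.resolve_right hzp
        exact le_antisymm (hdeg z) hz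
      rw [hx3]
      push_cast; ring
    · simp

theorem IsTree.sum_segWeight [Fintype V] [DecidableEq V] (hG : G.IsTree)
    (hdeg : ∀ z, (G.neighborSet z).ncard ≤ 3) {s : V → ℚ}
    (hs : ∀ a b, G.Adj a b → s a = -s b) :
    ∑ y, ∑ x, s x * ((if x = y then 1 else 2 / 3) * G.segWeight x y) =
      1 / 3 * ∑ y, s y * G.segWeight y y * (3 - (G.neighborSet y).ncard) := by
  rw [Finset.mul_sum]
  refine Finset.sum_congr rfl fun y _ => ?_
  have h := hG.sum_alternating_mul hs y (G.segWeight y)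
    fun x p hp hseg hx => segWeight_balance hG hdeg hp hseg hx
  have h2 : ∀ x, s x * ((if x = y then 1 else 2 / 3) * G.segWeight x y) =
      2 / 3 * (s x * G.segWeight y x) +
        if x = y then 1 / 3 * (s y * G.segWeight y y) else 0 := by
    intro x
    rw [segWeight_comm x y]
    split_ifs with hx
    · subst hx; ring
    · ring
  rw [Finset.sum_congr rfl fun x _ => h2 x, Finset.sum_add_distrib, ← Finset.mul_sum, h]
  simp only [Finset.sum_ite_eq', Finset.mem_univ, if_true]
  ring

open Classical in
/-- The total weight of the paths that cover the whole tree. -/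
lemma IsTree.sum_seg_eq_univ [Fintype V] (hG : G.IsTree)
    (hdeg : ∀ z, (G.neighborSet z).ncard ≤ 3) {s : V → ℚ}
    (hs : ∀ a b, G.Adj a b → s a = -s b) (hV : Nontrivial V) :
    ∑ y, ∑ x, s x * ((if x = y then 1 else 2 / 3) * if G.seg x y = Set.univ then 1 else 0) =
      1 / 3 * ∑ y, s y * G.segWeight y y * (3 - (G.neighborSet y).ncard) := by
  by_cases hB : ∃ b, 3 ≤ (G.neighborSet b).ncard
  · obtain ⟨b, hb⟩ := hB
    have h1 : ∀ x y, G.seg x y ≠ Set.univ := by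
      intro x y h
      have := hG.ncard_neighborSet_le_two h b
      omega
    have h2 : ∀ y, s y * G.segWeight y y * (3 - (G.neighborSet y).ncard) = 0 := by
      intro y
      rw [segWeight, seg_self]
      split_ifs with h
      · obtain rfl : b = y := h b hb
        have : (G.neighborSet b).ncard = 3 := le_antisymm (hdeg b) hb
        rw [this]
        push_cast; ring
      · ring
    simp [h1, h2]
  · push Not at hB
    have hle : ∀ z, (G.neighborSet z).ncard ≤ 2 := fun z => Nat.le_of_lt_succ (hB z)
    have hpos : ∀ z, 0 < (G.neighborSet z).ncard := by
      intro z
      obtain ⟨z', hz'⟩ := exists_ne z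
      obtain ⟨p, hp, -⟩ := hG.exists_parent hz'.symm
      exact (Set.ncard_pos).2 ⟨p, hp.symm⟩
    let ℓ : V → ℚ := fun z => 2 - (G.neighborSet z).ncard
    have hℓ : ∀ z, (G.neighborSet z).ncard = 1 ∧ ℓ z = 1 ∨ (G.neighborSet z).ncard = 2 ∧ ℓ z = 0 := by
      intro z
      have h1 := hpos z
      have h2 := hle z
      obtain h | h : (G.neighborSet z).ncard = 1 ∨ (G.neighborSet z).ncard = 2 := by omega
      · exact .inl ⟨h, by simp only [ℓ, h]; norm_num⟩
      · exact .inr ⟨h, by simp only [ℓ, h]; norm_num⟩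
    have hℓsum : ∑ z, ℓ z = 2 := by
      simp only [ℓ, Finset.sum_sub_distrib, hG.sum_degree]
      simp
      ring
    have hsℓ : ∑ z, s z * ℓ z = 2 * ∑ z, s z := by
      simp only [ℓ, mul_sub, Finset.sum_sub_distrib, hG.sum_alternating_mul_degree hs,
        ← Finset.sum_mul]
      ring
    have hrhs : ∀ y, s y * G.segWeight y y * (3 - (G.neighborSet y).ncard) = 4 * s y := by
      intro y
      have h3 : ∀ z, 3 ≤ (G.neighborSet z).ncard → z ∈ G.seg y y := fun z hz =>
        absurd (hB z) (not_lt.2 hz)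
      rw [segWeight, if_pos h3, seg_self, outerBoundary_singleton]
      rcases hℓ y with ⟨h, -⟩ | ⟨h, -⟩ <;> rw [h] <;> push_cast <;> ring
    have hlhs : ∀ x y, (if x = y then (1 : ℚ) else 2 / 3) *
        (if G.seg x y = Set.univ then 1 else 0) =
        2 / 3 * (ℓ x * ℓ y) - if x = y then 2 / 3 * ℓ y else 0 := by
      intro x y
      by_cases hxy : x = y
      · subst hxy
        have : G.seg x x ≠ Set.univ := by
          rw [seg_self]
          exact Set.singleton_ne_univ x
        rw [if_neg this, if_pos rfl, if_pos rfl]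
        rcases hℓ x with ⟨-, h⟩ | ⟨-, h⟩ <;> rw [h] <;> ring
      · rw [if_neg hxy, if_neg hxy]
        have hb := hG.ncard_outerBoundary_seg_of_le_two hle (Ne.symm hxy)
        have hiff : G.seg x y = Set.univ ↔ (G.outerBoundary (G.seg x y)).ncard = 0 := by
          refine ⟨fun h => by rw [h, ncard_outerBoundary_univ], fun h => ?_⟩
          by_contra hne
          rw [Set.ncard_eq_zero] at h
          exact (hG.outerBoundary_nonempty ⟨x, left_mem_seg x y⟩ hne).ne_empty h
        rcases hℓ x with ⟨hx, hx'⟩ | ⟨hx, hx'⟩ <;> rcases hℓ y with ⟨hy, hy'⟩ | ⟨hy, hy'⟩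
        · rw [if_pos (hiff.2 (by omega)), hx', hy']; ring
        all_goals rw [if_neg (fun h => by have := hiff.1 h; omega), hx', hy']; ring
    simp only [hrhs, hlhs, mul_sub, Finset.sum_sub_distrib, mul_ite, mul_zero, Finset.sum_ite_eq',
      Finset.mem_univ, if_true]
    have h5 : ∀ y, ∑ x, s x * (2 / 3 * (ℓ x * ℓ y)) = 2 / 3 * (∑ x, s x * ℓ x) * ℓ y := by
      intro y
      rw [Finset.mul_sum, Finset.sum_mul]
      exact Finset.sum_congr rfl fun x _ => by ring
    have h6 : ∑ y, s y * (2 / 3 * ℓ y) = 2 / 3 * ∑ y, s y * ℓ y := by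
      rw [Finset.mul_sum]
      exact Finset.sum_congr rfl fun x _ => by ring
    rw [Finset.sum_congr rfl fun y _ => h5 y, ← Finset.mul_sum, hℓsum, h6, hsℓ, ← Finset.mul_sum]
    ring

open Classical in
/-- The alternating sum over the odd paths of a tree that contain all branching vertices, but not
all vertices, vanishes. -/
theorem IsTree.sum_odd_paths_eq_zero [Fintype V] (hG : G.IsTree)
    (hdeg : ∀ z, (G.neighborSet z).ncard ≤ 3) {s : V → ℚ}
    (hs : ∀ a b, G.Adj a b → s a = -s b) (hs1 : ∀ a, s a = 1 ∨ s a = -1) :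
    ∑ y, ∑ x, (if s x = s y ∧ (∀ z, 3 ≤ (G.neighborSet z).ncard → z ∈ G.seg x y) ∧
        G.seg x y ≠ Set.univ then
      s x * ((if x = y then 1 else 2 / 3) * 2 ^ (G.outerBoundary (G.seg x y)).ncard) else 0) =
      0 := by
  rcases subsingleton_or_nontrivial V with hV | hV
  · have : ∀ x y, G.seg x y = Set.univ := fun x y =>
      Set.eq_univ_of_forall fun z => Subsingleton.elim x z ▸ left_mem_seg x y
    simp [this]
  let P : V → V → ℚ := fun x y => (if x = y then 1 else 2 / 3) * G.segWeight x y -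
    (if x = y then 1 else 2 / 3) * if G.seg x y = Set.univ then 1 else 0
  have hPsymm : ∀ x y, P x y = P y x := by
    intro x y
    simp only [P, segWeight_comm x y, seg_comm x y, eq_comm (a := x) (b := y)]
  have hP : ∑ y, ∑ x, s x * P x y = 0 := by
    simp only [P, mul_sub, Finset.sum_sub_distrib]
    rw [hG.sum_segWeight hdeg hs, hG.sum_seg_eq_univ hdeg hs hV, sub_self]
  have hterm : ∀ x y, (if s x = s y ∧ (∀ z, 3 ≤ (G.neighborSet z).ncard → z ∈ G.seg x y) ∧
        G.seg x y ≠ Set.univ then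
      s x * ((if x = y then 1 else 2 / 3) * 2 ^ (G.outerBoundary (G.seg x y)).ncard) else 0) =
      1 / 2 * (s x * P x y) + 1 / 2 * (s y * P y x) := by
    intro x y
    rw [hPsymm y x]
    have hPval : P x y = if (∀ z, 3 ≤ (G.neighborSet z).ncard → z ∈ G.seg x y) ∧
        G.seg x y ≠ Set.univ then
        (if x = y then 1 else 2 / 3) * 2 ^ (G.outerBoundary (G.seg x y)).ncard else 0 := by
      simp only [P, segWeight]
      by_cases hu : G.seg x y = Set.univ
      · rw [hu, ncard_outerBoundary_univ]
        simp
      · by_cases h : ∀ z, 3 ≤ (G.neighborSet z).ncard → z ∈ G.seg x y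
        · have h' := And.intro h hu
          rw [if_pos h, if_neg hu, if_pos h']; ring
        · have h' := fun h' : (∀ z, 3 ≤ (G.neighborSet z).ncard → z ∈ G.seg x y) ∧
            G.seg x y ≠ Set.univ => h h'.1
          rw [if_neg h, if_neg hu, if_neg h']; ring
    rw [hPval]
    by_cases hxy : s x = s y
    · simp only [hxy, true_and]
      split_ifs <;> ring
    · have : s y = -s x := by
        rcases hs1 x with h1 | h1 <;> rcases hs1 y with h2 | h2 <;> simp_all
      rw [if_neg fun h => hxy h.1, this]
      ring
  have hP' : ∑ y, ∑ x, s y * P y x = 0 := by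
    rw [Finset.sum_comm]
    exact hP
  trans 1 / 2 * (∑ y, ∑ x, s x * P x y) + 1 / 2 * ∑ y, ∑ x, s y * P y x
  · simp only [hterm, Finset.mul_sum, Finset.sum_add_distrib]
  · rw [hP, hP', mul_zero, add_zero]

end SimpleGraph

namespace RootedGraph

open SimpleGraph

variable {t : RootedGraph.{u}}

namespace ProperSubtree

lemma card_map_fiber (ht : t.IsTree) (w w' : t.ProperSubtree)
    [Decidable (∃ φ, map ht φ w = w')] :
    Nat.card {φ : t.graph ≃g t.graph // map ht φ w = w'} =
      if ∃ φ, map ht φ w = w' then Nat.card w.Stab else 0 := by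
  split_ifs with h
  · obtain ⟨φ, rfl⟩ := h
    refine Nat.card_congr
      { toFun := fun ψ => ⟨φ.symm.comp ψ.1, ?_, ?_⟩
        invFun := fun ψ => ⟨φ.comp ψ.1, ?_⟩
        left_inv := ?_
        right_inv := ?_ }
    · have h1 : ψ.1 w.root = φ w.root := congrArg ProperSubtree.root ψ.2
      exact (RelIso.symm_apply_eq φ).2 h1
    · have h1 : ψ.1 '' w.verts = φ '' w.verts := congrArg ProperSubtree.verts ψ.2
      exact (Set.image_comp φ.symm ψ.1 w.verts).trans
        ((congrArg (φ.symm '' ·) h1).trans (φ.toEquiv.symm_image_image w.verts))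
    · refine ext_verts ?_
      exact (Set.image_comp φ ψ.1 w.verts).trans (congrArg (φ '' ·) ψ.2.2)
    · intro ψ
      exact Subtype.ext (DFunLike.ext _ _ fun x => φ.apply_symm_apply _)
    · intro ψ
      exact Subtype.ext (DFunLike.ext _ _ fun x => φ.symm_apply_apply _)
  · have : IsEmpty {φ : t.graph ≃g t.graph // map ht φ w = w'} := ⟨fun φ => h ⟨φ.1, φ.2⟩⟩
    exact Nat.card_of_isEmpty

lemma mk_eq_iff_exists_map (ht : t.IsTree) (w w' : t.ProperSubtree) :
    Quotient.mk t.subtreeSetoid w = Quotient.mk t.subtreeSetoid w' ↔ ∃ φ, map ht φ w = w' := by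
  rw [Quotient.eq]
  exact exists_congr fun φ => ⟨fun h => ext_verts h, fun h => congrArg ProperSubtree.verts h⟩

/-- The orbit-stabilizer formula for subtrees. -/
lemma card_class_mul_card_stab (ht : t.IsTree) [Fintype t.ProperSubtree]
    [DecidableEq t.SubtreeClass] (w : t.ProperSubtree) :
    (Finset.univ.filter fun w' => Quotient.mk t.subtreeSetoid w' =
      Quotient.mk t.subtreeSetoid w).card * Nat.card w.Stab =
      Nat.card (t.graph ≃g t.graph) := by
  classical
  rw [Nat.card_congr (Equiv.sigmaFiberEquiv fun φ : t.graph ≃g t.graph => map ht φ w).symm,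
    Nat.card_sigma, Finset.sum_congr rfl fun w' _ => card_map_fiber ht w w', Finset.sum_ite,
    Finset.sum_const_zero, add_zero, Finset.sum_const, smul_eq_mul]
  congr 2
  refine Finset.filter_congr fun w' _ => ?_
  rw [← mk_eq_iff_exists_map ht, eq_comm]

/-- The contribution of a subtree to the sum over all subtrees. -/
noncomputable def weight (s : t.V → ℚ) (w : t.ProperSubtree) : ℚ :=
  2 ^ (t.graph.outerBoundary w.verts).ncard * w.coeff * s w.root *
    if w.verts.ncard = 1 then 1 else 2

lemma weight_map (ht : t.Admissible) {s : t.V → ℚ} (hs : ∀ a b, t.graph.Adj a b → s a = -s b)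
    (φ : t.graph ≃g t.graph) (w : t.ProperSubtree) : weight s (map ht.1 φ w) = weight s w := by
  have h1 : (map ht.1 φ w).verts.ncard = w.verts.ncard :=
    Set.ncard_image_of_injective _ φ.injective
  have h2 : (t.graph.outerBoundary (map ht.1 φ w).verts).ncard =
      (t.graph.outerBoundary w.verts).ncard := by
    change (t.graph.outerBoundary (φ '' w.verts)).ncard = _
    rw [outerBoundary_image, Set.ncard_image_of_injective _ φ.injective]
  have h3 : s (map ht.1 φ w).root = s w.root := ht.sign_apply hs φ w.root
  rw [weight, weight, coeff, coeff, h1, h2, h3]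

lemma alpha_div_sigma_mul_omega (ht : t.IsTree) (s : t.V → ℚ) (w : t.ProperSubtree) :
    (w.quot.alpha : ℚ) / (w.quot.sigma : ℚ) * w.coeff * s w.root * (w.omega : ℚ) *
      Nat.card w.Stab = weight s w := by
  have h1 := w.omega_mul_card_stab ht
  have hσ : (w.quot.sigma : ℚ) ≠ 0 := by
    rw [(ht.contract w.connected_induce).sigma_eq]
    have : Nonempty (RootIso w.quot w.quot) := ⟨⟨Iso.refl, rfl⟩⟩
    exact_mod_cast Nat.card_pos.ne'
  rw [card_rootIso] at h1
  have h2 : (w.omega : ℚ) * Nat.card w.Stab =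
      (if w.verts.ncard = 1 then 1 else 2) * w.quot.sigma := by
    exact_mod_cast h1
  rw [weight, alpha, contract_branchingNumber, mul_assoc _ (w.omega : ℚ), h2]
  push_cast
  field_simp

lemma exists_ends (ht : t.IsTree) {s : t.V → ℚ} (hs : ∀ a b, t.graph.Adj a b → s a = -s b)
    (w : t.ProperSubtree) : ∃ (k : ℕ) (a b : t.V), w.verts.ncard = 2 * k + 1 ∧
      (∀ x y, t.graph.seg x y = w.verts ↔ x = a ∧ y = b ∨ x = b ∧ y = a) ∧
      s w.root = (-1) ^ k * s a ∧ s b = s a ∧ (a = b ↔ k = 0) := by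
  have ht' : t.graph.IsTree := ht
  obtain ⟨k, ρ', hρ⟩ := w.path
  let ρ : pathGraph (2 * k + 1) ≃g t.graph.induce w.verts := ρ'
  refine ⟨k, (ρ 0).1, (ρ (Fin.last (2 * k))).1, ncard_of_pathGraph_iso ρ,
    fun x y => ht'.seg_eq_iff_of_iso ρ, ?_, ?_, ?_⟩
  · rw [← alternating_of_pathGraph_iso hs ρ k (by omega)]
    exact congrArg (fun a => s a.1) hρ.symm
  · refine (alternating_of_pathGraph_iso hs ρ (2 * k) (by omega)).trans ?_
    rw [pow_mul, neg_one_sq, one_pow, one_mul]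
  · constructor
    · intro h
      have := congrArg Fin.val (ρ.injective (Subtype.ext h))
      simpa [eq_comm] using this
    · rintro rfl
      rfl

open Classical in
lemma weight_eq_sum (ht : t.IsTree) [Fintype t.V] {s : t.V → ℚ}
    (hs : ∀ a b, t.graph.Adj a b → s a = -s b) (w : t.ProperSubtree) :
    weight s w = ∑ y, ∑ x, if t.graph.seg x y = w.verts then
      s x * ((if x = y then 1 else 2 / 3) *
        2 ^ (t.graph.outerBoundary (t.graph.seg x y)).ncard) else 0 := by
  obtain ⟨k, a, b, hn, hseg, hroot, hlast, hinj⟩ := w.exists_ends ht hs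
  have hsum : ∀ F : t.V → t.V → ℚ, (∑ y, ∑ x, if t.graph.seg x y = w.verts then F x y else 0) =
      if k = 0 then F a a else F a b + F b a := by
    intro F
    split_ifs with hk
    · obtain rfl := hinj.2 hk
      simp only [hseg, or_self, ite_and]
      simp
    · have hab : a ≠ b := fun h => hk (hinj.1 h)
      have : ∀ x y, (if t.graph.seg x y = w.verts then F x y else 0) =
          (if x = a then if y = b then F x y else 0 else 0) +
            if x = b then if y = a then F x y else 0 else 0 := by
        intro x y
        rw [if_congr (hseg x y) rfl rfl]
        by_cases h1 : x = a <;> by_cases h2 : x = b <;> by_cases h3 : y = a <;>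
          by_cases h4 : y = b <;> simp_all
      simp only [this, Finset.sum_add_distrib]
      simp
  rw [hsum, weight, coeff, hn, hroot]
  have hab : t.graph.seg a b = w.verts := (hseg a b).2 (.inl ⟨rfl, rfl⟩)
  have hba : t.graph.seg b a = w.verts := (hseg b a).2 (.inr ⟨rfl, rfl⟩)
  by_cases hk : k = 0
  · obtain rfl := hinj.2 hk
    rw [hab]
    simp [hk, mul_comm]
  · have hne : a ≠ b := fun h => hk (hinj.1 h)
    have h1 : 2 * k + 1 ≠ 1 := by omega
    have h2 : (2 * k + 1 - 1) / 2 = k := by omega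
    have h3 : ((-1 : ℚ) ^ k) * (-1) ^ k = 1 := by rw [← mul_pow]; simp
    rw [if_neg hk, if_neg h1, if_neg h1, if_neg hne, if_neg hne.symm, hab, hba, hlast, h2]
    linear_combination (4 / 3 * 2 ^ (t.graph.outerBoundary w.verts).ncard * s a) * h3

/-- The weights of all subtrees in `W(τ)` sum up to zero. -/
theorem sum_weight_eq_zero (ht : t.Admissible) [Fintype t.ProperSubtree] {s : t.V → ℚ}
    (hs : ∀ a b, t.graph.Adj a b → s a = -s b) (hs1 : ∀ a, s a = 1 ∨ s a = -1) :
    ∑ w : t.ProperSubtree, weight s w = 0 := by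
  classical
  have := Fintype.ofFinite t.V
  have ht' : t.graph.IsTree := ht.1
  have hs0 : ∀ a, s a ≠ 0 := fun a => by rcases hs1 a with h | h <;> rw [h] <;> norm_num
  rw [← ht'.sum_odd_paths_eq_zero ht.2.1 hs hs1,
    Finset.sum_congr rfl fun w _ => weight_eq_sum ht.1 hs w, Finset.sum_comm]
  refine Finset.sum_congr rfl fun y _ => ?_
  rw [Finset.sum_comm]
  refine Finset.sum_congr rfl fun x _ => ?_
  by_cases h : s x = s y ∧ (∀ z, 3 ≤ (t.graph.neighborSet z).ncard → z ∈ t.graph.seg x y) ∧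
      t.graph.seg x y ≠ Set.univ
  · rw [if_pos h]
    obtain ⟨w, hw⟩ := exists_verts_eq_seg ht.1 hs hs0 h.1 h.2.1 h.2.2
    rw [Finset.sum_eq_single w, if_pos hw.symm]
    · intro w' _ hne
      exact if_neg fun h' => hne (ext_verts (h'.symm.trans hw.symm))
    · simp
  · rw [if_neg h]
    refine Finset.sum_eq_zero fun w _ => if_neg fun hw => h ⟨?_, ?_, ?_⟩
    · obtain ⟨k, a, b, -, hseg, -, hab, -⟩ := w.exists_ends ht.1 hs
      rcases (hseg x y).1 hw with ⟨rfl, rfl⟩ | ⟨rfl, rfl⟩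
      · exact hab.symm
      · exact hab
    · intro z hz
      rw [hw]
      exact (ht.1.branchesOnlyAtRoot_contract_iff w.connected_induce).1 w.contract_mem z hz
    · rw [hw]
      exact w.strict

end ProperSubtree

end RootedGraph

theorem mainTheorem3 (τ : RootedGraph.{u}) (hτ : τ.Admissible)
    (l : τ.V → ℕ) (hl : τ.IsLabeling l)
    (rep : τ.SubtreeClass → τ.ProperSubtree)
    (hrep : ∀ q : τ.SubtreeClass, Quotient.mk τ.subtreeSetoid (rep q) = q) :
    τ.aggregated l rep = 0 := by
  classical
  have := Fintype.ofFinite τ.ProperSubtree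
  let s : τ.V → ℚ := fun x => (-1) ^ l x
  have hs : ∀ a b, τ.graph.Adj a b → s a = -s b := fun a b h => by
    simpa using congrArg (Int.cast : ℤ → ℚ) (hl a b h)
  have hs1 : ∀ a, s a = 1 ∨ s a = -1 := fun a => neg_one_pow_eq_or ℚ (l a)
  have hAut : (Nat.card (τ.graph ≃g τ.graph) : ℚ) ≠ 0 := by
    have : Nonempty (τ.graph ≃g τ.graph) := ⟨SimpleGraph.Iso.refl⟩
    exact_mod_cast Nat.card_pos.ne'
  refine (mul_eq_zero.1 ?_).resolve_right hAut
  rw [← RootedGraph.ProperSubtree.sum_weight_eq_zero hτ hs hs1, RootedGraph.aggregated,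
    Finset.sum_mul, ← Finset.sum_fiberwise Finset.univ (Quotient.mk τ.subtreeSetoid)]
  refine Finset.sum_congr rfl fun q _ => ?_
  have hconst : ∀ w ∈ Finset.univ.filter (fun w => Quotient.mk τ.subtreeSetoid w = q),
      RootedGraph.ProperSubtree.weight s w = RootedGraph.ProperSubtree.weight s (rep q) := by
    intro w hw
    obtain ⟨φ, rfl⟩ := (RootedGraph.ProperSubtree.mk_eq_iff_exists_map hτ.1 (rep q) w).1
      ((hrep q).trans (Finset.mem_filter.1 hw).2.symm)
    exact RootedGraph.ProperSubtree.weight_map hτ hs φ (rep q)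
  have hcard := RootedGraph.ProperSubtree.card_class_mul_card_stab hτ.1 (rep q)
  rw [hrep q] at hcard
  rw [Finset.sum_congr rfl hconst, Finset.sum_const, nsmul_eq_mul, ← hcard,
    ← RootedGraph.ProperSubtree.alpha_div_sigma_mul_omega hτ.1 s (rep q)]
  push_cast
  ring
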